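/- Let $\mathbb R^+=[0,\infty)$. Let $L^1_{\mathrm{loc}}$ be the space of (classes of) locally integrable complex functions on $\mathbb R^+$, with the Fréchet topology given by the seminorms $f\mapsto\int_0^n|f(t)|\,dt$ ($n\in\mathbb N$), and let $M_{\mathrm{loc}}$ be the space of locally finite complex Borel measures on $\mathbb R^+$, with the Fréchet topology given by the seminorms $\mu\mapsto|\mu|([0,n))$ ($n\in\mathbb N$). Let $(Xf)(t)=tf(t)$ for $f\in L^1_{\mathrm{loc}}$ and $d(X\nu)(t)=t\,d\nu(t)$ for $\nu\in M_{\mathrm{loc}}$. For $\mu\in M_{\mathrm{loc}}$ define $$D_\mu f=Xf*\mu\quad(f\in L^1_{\mathrm{loc}}),\qquad \overline D_\mu\nu=X\nu*\mu\quad(\nu\in M_{\mathrm{loc}}),$$ where $(g*\mu)(t)=\int_{[0,t]}g(t-s)\,d\mu(s)$ for $g\in L^1_{\mathrm{loc}}$ (and almost every $t$), and $\rho*\mu$ for $\rho\in M_{\mathrm{loc}}$ is the measure with $(\rho*\mu)(A)=(\rho\times\mu)(\{(x,y):x+y\in A\})$ for every bounded Borel set $A\subseteq\mathbb R^+$. A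 linear operator between Fréchet spaces is called Montel (respectively weakly Montel) if it maps bounded sets to relatively compact (respectively weakly relatively compact) sets. **Theorem.** For every $\mu\in M_{\mathrm{loc}}$ the following conditions are equivalent: (a) $D_\mu$ is a Montel operator on $L^1_{\mathrm{loc}}$; (b) $D_\mu$ is a weakly Montel operator on $L^1_{\mathrm{loc}}$; (c) $\mu$ is absolutely continuous with respect to Lebesgue measure on $\mathbb R^+$; (d) $\overline D_\mu$ is a Montel operator on $M_{\mathrm{loc}}$; (e) $\overline D_\mu$ is a weakly Montel operator on $M_{\mathrm{loc}}$. -/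

import Mathlib

noncomputable section

open MeasureTheory Set Filter Topology
open scoped NNReal ENNReal

namespace LocConv

/-! ### Complex measures -/

section ComplexMeasures

variable {X : Type*} [MeasurableSpace X]

instance isFiniteMeasure_variation (m : ComplexMeasure X) : IsFiniteMeasure m.variation := by
  have h : m.variation ≤ (ComplexMeasure.re m).variation + (ComplexMeasure.im m).variation := by
    apply VectorMeasure.variation_le_of_forall_enorm_le
    intro E hE
    have h1 := VectorMeasure.enorm_measure_le_variation (ComplexMeasure.re m) E
    have h2 := VectorMeasure.enorm_measure_le_variation (ComplexMeasure.im m) E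
    have h3 : ‖m E‖ₑ ≤ ‖(ComplexMeasure.re m) E‖ₑ + ‖(ComplexMeasure.im m) E‖ₑ := by
      have : ‖m E‖ ≤ ‖(m E).re‖ + ‖(m E).im‖ := Complex.norm_le_abs_re_add_abs_im _
      rw [← ofReal_norm, ← ofReal_norm, ← ofReal_norm, ← ENNReal.ofReal_add (by positivity) (by positivity)]
      exact ENNReal.ofReal_le_ofReal this
    exact h3.trans (add_le_add h1 h2)
  have hr : IsFiniteMeasure (ComplexMeasure.re m).variation := by
    rw [← SignedMeasure.totalVariation_eq_variation]; unfold SignedMeasure.totalVariation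
    infer_instance
  have hi : IsFiniteMeasure (ComplexMeasure.im m).variation := by
    rw [← SignedMeasure.totalVariation_eq_variation]; unfold SignedMeasure.totalVariation
    infer_instance
  exact isFiniteMeasure_of_le _ h

/-- The pairing used to integrate a complex function against a complex measure. -/
abbrev mulC : ℂ →L[ℝ] ℂ →L[ℝ] ℂ := ContinuousLinearMap.mul ℝ ℂ

theorem exists_density (m : ComplexMeasure X) :
    ∃ h : X → ℂ, Integrable h m.variation ∧ m.variation.withDensityᵥ h = m := by
  have hm : m ≪ᵥ m.variation.toENNRealVectorMeasure := by
    intro s hs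
    by_cases hms : MeasurableSet s
    · rw [Measure.toENNRealVectorMeasure_apply_measurable hms] at hs
      have := VectorMeasure.enorm_measure_le_variation m s
      rw [hs] at this
      simpa using this
    · exact m.not_measurable hms
  rw [ComplexMeasure.absolutelyContinuous_ennreal_iff] at hm
  have hr := SignedMeasure.withDensityᵥ_rnDeriv_eq _ _ hm.1
  have hi := SignedMeasure.withDensityᵥ_rnDeriv_eq _ _ hm.2
  set r := (ComplexMeasure.re m).rnDeriv m.variation
  set i := (ComplexMeasure.im m).rnDeriv m.variation
  have ir : Integrable r m.variation := SignedMeasure.integrable_rnDeriv _ _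
  have ii : Integrable i m.variation := SignedMeasure.integrable_rnDeriv _ _
  have ih : Integrable (fun x => (r x : ℂ) + (i x : ℂ) * Complex.I) m.variation :=
    ir.ofReal.add (ii.ofReal.mul_const _)
  refine ⟨_, ih, ?_⟩
  ext s hs
  have ir' : Integrable (fun x => (r x : ℂ)) (m.variation.restrict s) := ir.ofReal.restrict
  have ii' : Integrable (fun x => (i x : ℂ) * Complex.I) (m.variation.restrict s) :=
    (ii.ofReal.mul_const _).restrict
  rw [withDensityᵥ_apply ih hs, integral_add ir' ii', integral_mul_const, integral_complex_ofReal,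
    integral_complex_ofReal]
  rw [← withDensityᵥ_apply ir hs, ← withDensityᵥ_apply ii hs, hr, hi]
  exact Complex.re_add_im _

theorem lintegral_mul_density {ρ : Measure X} {h : X → ℂ} (hh : Integrable h ρ) {f : X → ℂ}
    (hf : AEStronglyMeasurable f (ρ.withDensityᵥ h).variation) :
    ∫⁻ x, ‖f x * h x‖ₑ ∂ρ = ∫⁻ x, ‖f x‖ₑ ∂(ρ.withDensityᵥ h).variation := by
  rw [Measure.variation_withDensityᵥ hh] at hf ⊢
  rw [lintegral_withDensity_eq_lintegral_mul₀' hh.aestronglyMeasurable.enorm hf.enorm]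
  simp only [enorm_mul, Pi.mul_apply, mul_comm]

theorem integrable_mul_density {ρ : Measure X} {h : X → ℂ} (hh : Integrable h ρ) {f : X → ℂ}
    (hf : (ρ.withDensityᵥ h).Integrable f) : Integrable (fun x => f x * h x) ρ := by
  refine ⟨?_, ?_⟩
  · have h1 : AEStronglyMeasurable f (ρ.withDensity fun x => ‖h x‖ₑ) := by
      rw [← Measure.variation_withDensityᵥ hh]; exact hf.1
    obtain ⟨g, hg, hfg⟩ := h1
    refine (hg.aestronglyMeasurable.mul hh.1).congr ?_
    rw [Filter.EventuallyEq, ae_withDensity_iff' hh.aestronglyMeasurable.enorm] at hfg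
    filter_upwards [hfg] with x hx
    by_cases h0 : h x = 0
    · simp [h0]
    · simp [hx (by simpa using h0)]
  · have := hf.2
    rw [HasFiniteIntegral] at this ⊢
    rwa [lintegral_mul_density hh hf.1]

/-- If `m = h ρ`, then `∫ f dm = ∫ f h dρ`. -/
theorem integral_withDensity {ρ : Measure X} {h : X → ℂ}
    (hh : Integrable h ρ) {f : X → ℂ} (hf : (ρ.withDensityᵥ h).Integrable f) :
    ∫ᵛ x, f x ∂[mulC; ρ.withDensityᵥ h] = ∫ x, f x * h x ∂ρ := by
  have hv := Measure.variation_withDensityᵥ hh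
  refine hf.induction (P := fun f => ∫ᵛ x, f x ∂[mulC; ρ.withDensityᵥ h] = ∫ x, f x * h x ∂ρ)
    ?_ ?_ ?_ ?_
  · intro c s hs hc
    rw [VectorMeasure.integral_indicator_const _ hs]
    rw [withDensityᵥ_apply hh hs]
    simp only [ContinuousLinearMap.mul_apply']
    rw [← integral_const_mul, ← integral_indicator hs]
    congr 1; ext x
    by_cases hx : x ∈ s <;> simp [hx]
  · intro f g _ hf hg h1 h2
    have := VectorMeasure.integral_add (B := mulC) hf hg
    rw [this, h1, h2, ← integral_add (integrable_mul_density hh hf) (integrable_mul_density hh hg)]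
    congr 1; ext x; simp [add_mul]
  · refine isClosed_eq VectorMeasure.continuous_integral ?_
    refine (LipschitzWith.of_dist_le_mul (K := 1) fun f g => ?_).continuous
    have hf := L1.integrable_coeFn f
    have hg := L1.integrable_coeFn g
    rw [dist_eq_norm, dist_eq_norm, L1.norm_sub_eq_lintegral, NNReal.coe_one, one_mul,
      ← integral_sub (integrable_mul_density hh hf) (integrable_mul_density hh hg)]
    refine (norm_integral_le_lintegral_norm _).trans ?_
    simp only [ofReal_norm, ← sub_mul]
    rw [← lintegral_mul_density hh (f := fun x => f x - g x) (hf.1.sub hg.1)]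
  · intro f g hfg hf h1
    rw [← VectorMeasure.integral_congr_ae hfg, h1]
    rw [hv, Filter.EventuallyEq, ae_withDensity_iff' hh.aestronglyMeasurable.enorm] at hfg
    apply integral_congr_ae
    filter_upwards [hfg] with x hx
    by_cases h0 : h x = 0
    · simp [h0]
    · simp [hx (by simpa using h0)]

theorem integrable_smul_measure (c : ℂ) {m : ComplexMeasure X} {f : X → ℂ} (hf : m.Integrable f) :
    (c • m).Integrable f := by
  rw [VectorMeasure.Integrable, VectorMeasure.variation_smul]
  exact Integrable.smul_measure_nnreal hf

theorem integral_complex_smul (c : ℂ) (m : ComplexMeasure X) {f : X → ℂ} (hf : m.Integrable f) :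
    ∫ᵛ x, f x ∂[mulC; c • m] = c * ∫ᵛ x, f x ∂[mulC; m] := by
  obtain ⟨h, hh, hm⟩ := exists_density m
  generalize m.variation = ρ at hh hm
  subst hm
  have hf' := integrable_smul_measure c hf
  rw [integral_withDensity hh hf]
  rw [← withDensityᵥ_smul h c] at hf' ⊢
  rw [integral_withDensity (hh.smul c) hf', ← integral_const_mul]
  congr 1; ext x; simp; ring

end ComplexMeasures


/-! ### Locally finite complex Borel measures on `ℝ⁺ = [0, ∞)` -/

/-- The vector space of locally finite complex Borel measures on `ℝ⁺`, realised as the functions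
on the bounded Borel subsets of `ℝ⁺` (extended by `0` to all subsets) that are countably additive
on disjoint sequences of Borel sets with bounded union. -/
def mLocSubmodule : Submodule ℂ (Set ℝ≥0 → ℂ) where
  carrier := {m | (∀ s, ¬ (MeasurableSet s ∧ Bornology.IsBounded s) → m s = 0) ∧
    ∀ A : ℕ → Set ℝ≥0, (∀ i, MeasurableSet (A i)) → Pairwise (Function.onFun Disjoint A) →
      Bornology.IsBounded (⋃ i, A i) → HasSum (fun i => m (A i)) (m (⋃ i, A i))}
  zero_mem' := ⟨fun _ _ => rfl, fun _ _ _ _ => by simp⟩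
  add_mem' := fun {a b} ha hb => ⟨fun s hs => by simp [ha.1 s hs, hb.1 s hs],
    fun A hA hd hB => (ha.2 A hA hd hB).add (hb.2 A hA hd hB)⟩
  smul_mem' := fun c a ha => ⟨fun s hs => by simp [ha.1 s hs],
    fun A hA hd hB => (ha.2 A hA hd hB).const_smul c⟩

/-- The space `M_loc` of locally finite complex Borel measures on `ℝ⁺`. -/
def MLoc : Type := ↥mLocSubmodule

instance : AddCommGroup MLoc := inferInstanceAs (AddCommGroup ↥mLocSubmodule)
instance : Module ℂ MLoc := inferInstanceAs (Module ℂ ↥mLocSubmodule)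

namespace MLoc

/-- The value `μ(s)` of a locally finite measure on a (bounded Borel) set `s`. -/
def val (μ : MLoc) (s : Set ℝ≥0) : ℂ := μ.1 s

@[simp] theorem val_add (μ ν : MLoc) (s : Set ℝ≥0) : (μ + ν).val s = μ.val s + ν.val s := rfl
@[simp] theorem val_smul (c : ℂ) (μ : MLoc) (s : Set ℝ≥0) : (c • μ).val s = c * μ.val s := rfl

theorem val_eq_zero (μ : MLoc) {s : Set ℝ≥0} (hs : ¬ (MeasurableSet s ∧ Bornology.IsBounded s)) :
    μ.val s = 0 := μ.2.1 s hs

theorem hasSum_val (μ : MLoc) {A : ℕ → Set ℝ≥0} (hA : ∀ i, MeasurableSet (A i))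
    (hd : Pairwise (Function.onFun Disjoint A)) (hB : Bornology.IsBounded (⋃ i, A i)) :
    HasSum (fun i => μ.val (A i)) (μ.val (⋃ i, A i)) := μ.2.2 A hA hd hB

theorem ext {μ ν : MLoc}
    (h : ∀ s, MeasurableSet s → Bornology.IsBounded s → μ.val s = ν.val s) : μ = ν := by
  apply Subtype.ext
  funext s
  by_cases hs : MeasurableSet s ∧ Bornology.IsBounded s
  · exact h s hs.1 hs.2
  · exact (μ.val_eq_zero hs).trans (ν.val_eq_zero hs).symm

theorem isBounded_Iio (a : ℝ≥0) : Bornology.IsBounded (Iio a) :=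
  (Metric.isBounded_Icc (0 : ℝ≥0) a).subset fun _ hx => ⟨zero_le, le_of_lt hx⟩

theorem isBounded_iff {s : Set ℝ≥0} : Bornology.IsBounded s ↔ ∃ n : ℕ, s ⊆ Iio (n : ℝ≥0) := by
  constructor
  · intro h
    obtain ⟨b, hb⟩ := h.bddAbove
    obtain ⟨n, hn⟩ := exists_nat_gt b
    exact ⟨n, fun x hx => lt_of_le_of_lt (hb hx) hn⟩
  · rintro ⟨n, hn⟩
    exact (isBounded_Iio _).subset hn

/-- The restriction `R_n μ` of `μ ∈ M_loc` to `[0, n)`, a finite complex measure on `ℝ⁺` that is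
carried by `[0, n)`. -/
def restr (n : ℕ) (μ : MLoc) : ComplexMeasure ℝ≥0 where
  measureOf' s := open scoped Classical in if MeasurableSet s then μ.val (s ∩ Iio (n : ℝ≥0)) else 0
  empty' := by
    simp only [MeasurableSet.empty, if_true, empty_inter]
    have := μ.hasSum_val (A := fun _ => ∅) (by simp) (by intro i j _; simp [Function.onFun])
      (by simp)
    simp only [iUnion_empty] at this
    by_contra h
    have h2 := this.summable.tendsto_atTop_zero
    rw [tendsto_const_nhds_iff] at h2
    exact h h2
  not_measurable' s hs := by simp [hs]
  m_iUnion' A hA hd := by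
    simp only [hA, MeasurableSet.iUnion hA, if_true, iUnion_inter]
    apply μ.hasSum_val (fun i => (hA i).inter measurableSet_Iio)
      (fun i j hij => (hd hij).mono inter_subset_left inter_subset_left)
    rw [← iUnion_inter]
    exact (isBounded_Iio _).subset inter_subset_right

theorem restr_apply (n : ℕ) (μ : MLoc) {s : Set ℝ≥0} (hs : MeasurableSet s) :
    restr n μ s = μ.val (s ∩ Iio (n : ℝ≥0)) := if_pos hs

theorem restr_apply_of_subset {n : ℕ} (μ : MLoc) {s : Set ℝ≥0} (hs : MeasurableSet s)
    (hn : s ⊆ Iio (n : ℝ≥0)) : restr n μ s = μ.val s := by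
  rw [restr_apply n μ hs, inter_eq_left.2 hn]

theorem restr_add (n : ℕ) (μ ν : MLoc) : restr n (μ + ν) = restr n μ + restr n ν := by
  ext s hs
  simp [restr_apply _ _ hs]

theorem restr_smul (n : ℕ) (c : ℂ) (μ : MLoc) : restr n (c • μ) = c • restr n μ := by
  ext s hs
  simp [restr_apply _ _ hs]

theorem restrict_restr {n k : ℕ} (μ : MLoc) {s : Set ℝ≥0} (hn : s ⊆ Iio (n : ℝ≥0))
    (hk : s ⊆ Iio (k : ℝ≥0)) : (restr n μ).restrict s = (restr k μ).restrict s := by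
  by_cases hs : MeasurableSet s
  · ext t ht
    rw [VectorMeasure.restrict_apply _ hs ht, VectorMeasure.restrict_apply _ hs ht,
      restr_apply_of_subset μ (ht.inter hs) (inter_subset_right.trans hn),
      restr_apply_of_subset μ (ht.inter hs) (inter_subset_right.trans hk)]
  · simp [VectorMeasure.restrict_not_measurable _ hs]

theorem variation_restr_compl (n : ℕ) (μ : MLoc) :
    (restr n μ).variation (Iio (n : ℝ≥0))ᶜ = 0 := by
  rw [VectorMeasure.variation_apply_eq_zero measurableSet_Iio.compl]
  intro t hts ht
  rw [restr_apply n μ ht]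
  have : t ∩ Iio (n : ℝ≥0) = ∅ := by
    ext x; simp only [mem_inter_iff, mem_empty_iff_false, iff_false]
    exact fun h => hts h.1 h.2
  rw [this, ← empty_inter (Iio (n : ℝ≥0)), ← restr_apply n μ MeasurableSet.empty]
  simp

theorem restrict_restr_self (n : ℕ) (μ : MLoc) :
    (restr n μ).restrict (Iio (n : ℝ≥0)) = restr n μ := by
  ext t ht
  rw [VectorMeasure.restrict_apply _ measurableSet_Iio ht, restr_apply _ _ ht,
    restr_apply _ _ (ht.inter measurableSet_Iio), inter_assoc, inter_self]

/-- The locally finite measure with `μ(s) = m n s` for every `n` and every Borel set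
`s ⊆ [0, n)`, where `m` is a compatible sequence of complex measures. -/
def glue (m : ℕ → ComplexMeasure ℝ≥0) (hm : ∀ n k : ℕ, ∀ s : Set ℝ≥0, MeasurableSet s →
    s ⊆ Iio (n : ℝ≥0) → s ⊆ Iio (k : ℝ≥0) → m n s = m k s) : MLoc :=
  ⟨fun s => open scoped Classical in
    if h : MeasurableSet s ∧ Bornology.IsBounded s then m (isBounded_iff.1 h.2).choose s else 0,
   fun s hs => dif_neg hs, by
    intro A hA hd hB
    have hU := (isBounded_iff.1 hB).choose_spec
    set n := (isBounded_iff.1 hB).choose with hn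
    have h1 : ∀ i, A i ⊆ Iio (n : ℝ≥0) := fun i => (subset_iUnion A i).trans hU
    have h2 : ∀ i, Bornology.IsBounded (A i) := fun i => isBounded_iff.2 ⟨n, h1 i⟩
    simp only [hA, h2, hB, MeasurableSet.iUnion hA, and_self, dif_pos]
    have h3 := (m n).hasSum_of_disjoint_iUnion hA hd
    convert h3 using 2 with i
    exact hm _ _ _ (hA i) (isBounded_iff.1 (h2 i)).choose_spec (h1 i)⟩

theorem glue_val (m : ℕ → ComplexMeasure ℝ≥0) (hm : ∀ n k : ℕ, ∀ s : Set ℝ≥0, MeasurableSet s →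
    s ⊆ Iio (n : ℝ≥0) → s ⊆ Iio (k : ℝ≥0) → m n s = m k s) {n : ℕ} {s : Set ℝ≥0}
    (hs : MeasurableSet s) (hn : s ⊆ Iio (n : ℝ≥0)) : (glue m hm).val s = m n s := by
  have h : MeasurableSet s ∧ Bornology.IsBounded s := ⟨hs, isBounded_iff.2 ⟨n, hn⟩⟩
  have : (glue m hm).val s = m (isBounded_iff.1 h.2).choose s := dif_pos h
  rw [this]
  exact hm _ _ _ hs (isBounded_iff.1 h.2).choose_spec hn

/-- The seminorm `μ ↦ ‖R_n μ‖` (total variation norm on `M[0, n)`). -/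
def seminorm (n : ℕ) : Seminorm ℂ MLoc :=
  Seminorm.of (fun μ => (restr n μ).variation.real univ)
    (fun μ ν => by
      rw [restr_add]
      calc ((restr n μ + restr n ν).variation).real univ
          ≤ ((restr n μ).variation + (restr n ν).variation).real univ := by
            apply ENNReal.toReal_mono (measure_ne_top _ _)
            exact VectorMeasure.variation_add_le univ
        _ = _ := measureReal_add_apply)
    (fun c μ => by
      rw [restr_smul, VectorMeasure.variation_smul]
      simp)

/-- The topology of `M_loc`, given by the seminorms `μ ↦ ‖R_n μ‖`. -/
instance : TopologicalSpace MLoc := (SeminormFamily.moduleFilterBasis (𝕜 := ℂ) seminorm).topology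

theorem withSeminorms : WithSeminorms (𝕜 := ℂ) seminorm := ⟨rfl⟩

instance : IsTopologicalAddGroup MLoc := withSeminorms.topologicalAddGroup
instance : ContinuousSMul ℂ MLoc := withSeminorms.continuousSMul

theorem integrable_id_restr (n : ℕ) (μ : MLoc) :
    (restr n μ).Integrable (fun x : ℝ≥0 => ((x : ℝ) : ℂ)) := by
  refine Integrable.of_bound (C := n) ?_ ?_
  · exact (Complex.continuous_ofReal.comp NNReal.continuous_coe).aestronglyMeasurable
  · have h := variation_restr_compl n μ
    have h2 : ∀ᵐ x ∂(restr n μ).variation, x ∈ Iio (n : ℝ≥0) := h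
    filter_upwards [h2] with x hx
    have : (x : ℝ) ≤ n := by exact_mod_cast le_of_lt hx
    simpa using this

/-- The operator `X` on `M_loc`: `d(Xν)(t) = t dν(t)`. -/
def X : MLoc →ₗ[ℂ] MLoc where
  toFun ν := glue (fun n => (restr n ν).withDensity (fun x : ℝ≥0 => ((x : ℝ) : ℂ)) mulC) (by
    intro n k s hs hn hk
    rw [VectorMeasure.withDensity_apply (integrable_id_restr n ν),
      VectorMeasure.withDensity_apply (integrable_id_restr k ν), restrict_restr ν hn hk])
  map_add' μ ν := by
    apply ext
    intro s hs hb
    obtain ⟨n, hn⟩ := isBounded_iff.1 hb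
    rw [val_add, glue_val _ _ hs hn, glue_val _ _ hs hn, glue_val _ _ hs hn, 
      VectorMeasure.withDensity_apply (integrable_id_restr n _),
      VectorMeasure.withDensity_apply (integrable_id_restr n _),
      VectorMeasure.withDensity_apply (integrable_id_restr n _), restr_add,
      VectorMeasure.restrict_add, VectorMeasure.integral_add_vectorMeasure
        (integrable_id_restr n μ).restrict (integrable_id_restr n ν).restrict]
  map_smul' c ν := by
    apply ext
    intro s hs hb
    obtain ⟨n, hn⟩ := isBounded_iff.1 hb
    rw [RingHom.id_apply, val_smul, glue_val _ _ hs hn, glue_val _ _ hs hn,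
      VectorMeasure.withDensity_apply (integrable_id_restr n _),
      VectorMeasure.withDensity_apply (integrable_id_restr n _), restr_smul,
      VectorMeasure.restrict_smul, integral_complex_smul _ _ (integrable_id_restr n ν).restrict]

/-- The convolution of two finite complex measures on `ℝ⁺`: the image of the product measure under
addition. -/
def finConv (a b : ComplexMeasure ℝ≥0) : ComplexMeasure ℝ≥0 :=
  (a.prod b mulC).map fun p => p.1 + p.2

theorem finConv_apply (a b : ComplexMeasure ℝ≥0) {s : Set ℝ≥0} (hs : MeasurableSet s) :
    finConv a b s = ∫ᵛ x, b ((fun y => x + y) ⁻¹' s) ∂[mulC; a] := by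
  have hm : Measurable fun p : ℝ≥0 × ℝ≥0 => p.1 + p.2 := measurable_add
  rw [finConv, VectorMeasure.map_apply _ hm hs, VectorMeasure.prod_apply_eq_integral (hm hs)]
  have : mulC.flip = mulC := by ext; simp
  rw [this]
  rfl

theorem finConv_add (a a' b : ComplexMeasure ℝ≥0) :
    finConv (a + a') b = finConv a b + finConv a' b := by
  unfold finConv
  rw [← VectorMeasure.map_add]
  congr 1
  apply VectorMeasure.prod_eq_of_forall_apply_prod
  intro s t _ _
  simp

theorem finConv_smul (c : ℂ) (a b : ComplexMeasure ℝ≥0) :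
    finConv (c • a) b = c • finConv a b := by
  unfold finConv
  rw [← VectorMeasure.map_smul]
  congr 1
  apply VectorMeasure.prod_eq_of_forall_apply_prod
  intro s t _ _
  simp [mul_assoc]

theorem finConv_restr (ν μ : MLoc) {n k : ℕ} {s : Set ℝ≥0} (hs : MeasurableSet s)
    (hn : s ⊆ Iio (n : ℝ≥0)) (hk : s ⊆ Iio (k : ℝ≥0)) :
    finConv (restr n ν) (restr n μ) s = finConv (restr k ν) (restr k μ) s := by
  have key : ∀ j : ℕ, s ⊆ Iio (j : ℝ≥0) → ∀ i : ℕ, i = min n k → s ⊆ Iio (i : ℝ≥0) → i ≤ j →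
      finConv (restr j ν) (restr j μ) s = finConv (restr i ν) (restr i μ) s := by
    intro j hj i _ hi hij
    have hij' : (i : ℝ≥0) ≤ j := by exact_mod_cast hij
    have hsub : ∀ x : ℝ≥0, (fun y => x + y) ⁻¹' s ⊆ Iio (i : ℝ≥0) := fun x y hy =>
      lt_of_le_of_lt (le_add_self : y ≤ x + y) (hi hy)
    have hms : ∀ x : ℝ≥0, MeasurableSet ((fun y => x + y) ⁻¹' s) := fun x =>
      (measurable_const_add x) hs
    rw [finConv_apply _ _ hs, finConv_apply _ _ hs]
    rw [← VectorMeasure.setIntegral_eq_integral_of_forall_compl_eq_zero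
      (s := Iio (i : ℝ≥0)) measurableSet_Iio (μ := restr j ν)]
    · rw [← restrict_restr_self i ν, restrict_restr ν (s := Iio (i : ℝ≥0)) (n := j) (k := i)
        (Iio_subset_Iio hij') subset_rfl]
      congr 1
      ext x
      rw [restr_apply_of_subset μ (hms x) (hsub x),
        restr_apply_of_subset μ (hms x) ((hsub x).trans (Iio_subset_Iio hij'))]
    · intro x hx
      have : (fun y => x + y) ⁻¹' s = ∅ := by
        ext y
        simp only [mem_preimage, mem_empty_iff_false, iff_false]
        intro hy
        exact hx (lt_of_le_of_lt (le_self_add : x ≤ x + y) (hi hy))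
      rw [this]; simp
  have hi : s ⊆ Iio ((min n k : ℕ) : ℝ≥0) := by
    rcases le_total n k with h | h <;> simp [h, hn, hk]
  rw [key n hn _ rfl hi (min_le_left _ _), key k hk _ rfl hi (min_le_right _ _)]

/-- Convolution with `μ` on `M_loc`: for every `n` and every Borel set `s ⊆ [0, n)` one has
`(ν * μ)(s) = (R_n ν * R_n μ)(s) = (R_n ν × R_n μ) {(x, y) : x + y ∈ s}`. -/
def conv (μ : MLoc) : MLoc →ₗ[ℂ] MLoc where
  toFun ν := glue (fun n => finConv (restr n ν) (restr n μ))
    (fun _ _ _ hs hn hk => finConv_restr ν μ hs hn hk)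
  map_add' a b := by
    apply ext
    intro s hs hb
    obtain ⟨n, hn⟩ := isBounded_iff.1 hb
    rw [val_add, glue_val _ _ hs hn, glue_val _ _ hs hn, glue_val _ _ hs hn, restr_add, finConv_add]
    rfl
  map_smul' c a := by
    apply ext
    intro s hs hb
    obtain ⟨n, hn⟩ := isBounded_iff.1 hb
    rw [RingHom.id_apply, val_smul, glue_val _ _ hs hn, glue_val _ _ hs hn, restr_smul,
      finConv_smul]
    rfl

end MLoc

/-! ### The space `L¹_loc` -/

/-- Lebesgue measure on `ℝ⁺ = [0, ∞)`. -/
def leb : Measure ℝ≥0 := (volume : Measure ℝ).comap ((↑) : ℝ≥0 → ℝ)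

theorem measurableEmbedding_coe : MeasurableEmbedding ((↑) : ℝ≥0 → ℝ) :=
  MeasurableEmbedding.subtype_coe measurableSet_Ici

theorem leb_apply (s : Set ℝ≥0) : leb s = volume (((↑) : ℝ≥0 → ℝ) '' s) :=
  measurableEmbedding_coe.comap_apply _ _

theorem leb_Icc (a b : ℝ≥0) : leb (Icc a b) = ENNReal.ofReal (b - a) := by
  rw [leb_apply]
  have : ((↑) : ℝ≥0 → ℝ) '' Icc a b = Icc (a : ℝ) b := by
    ext x
    constructor
    · rintro ⟨y, hy, rfl⟩
      exact ⟨by exact_mod_cast hy.1, by exact_mod_cast hy.2⟩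
    · intro hx
      exact ⟨⟨x, a.2.trans hx.1⟩, ⟨hx.1, hx.2⟩, rfl⟩
  rw [this, Real.volume_Icc]

instance : IsLocallyFiniteMeasure leb := by
  refine ⟨fun x => ⟨Icc 0 (x + 1), ?_, ?_⟩⟩
  · have : Icc (0 : ℝ≥0) (x + 1) = Iic (x + 1) := by ext; simp
    rw [this]
    exact Iic_mem_nhds (lt_add_one x)
  · rw [leb_Icc]; exact ENNReal.ofReal_lt_top

/-- Translation on `ℝ⁺`: the image of Lebesgue measure under `x ↦ x + s` is Lebesgue measure on
`[s, ∞)`. -/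
theorem map_add_leb (s : ℝ≥0) : leb.map (fun x => x + s) = leb.restrict (Ici s) := by
  ext A hA
  rw [Measure.map_apply (measurable_add_const s) hA, Measure.restrict_apply hA, leb_apply, leb_apply]
  have : ((↑) : ℝ≥0 → ℝ) '' ((fun x => x + s) ⁻¹' A) =
      (fun x : ℝ => x + s) ⁻¹' (((↑) : ℝ≥0 → ℝ) '' (A ∩ Ici s)) := by
    ext x
    constructor
    · rintro ⟨y, hy, rfl⟩
      exact ⟨y + s, ⟨hy, mem_Ici.2 le_add_self⟩, by simp⟩
    · rintro ⟨y, ⟨hy, hys⟩, hyx⟩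
      have hys' : (s : ℝ) ≤ y := by exact_mod_cast hys
      refine ⟨y - s, ?_, ?_⟩
      · rw [mem_preimage, tsub_add_cancel_of_le hys]; exact hy
      · rw [NNReal.coe_sub hys]; simp at hyx; linarith
  rw [this, measure_preimage_add_right]

theorem lintegral_Ici_sub (s : ℝ≥0) {F : ℝ≥0 → ℝ≥0∞} (hF : Measurable F) :
    ∫⁻ t in Ici s, F (t - s) ∂leb = ∫⁻ x, F x ∂leb := by
  rw [← map_add_leb, lintegral_map (by fun_prop) (by fun_prop)]
  simp

/-- `L¹_loc`: the (classes of) functions on `ℝ⁺` that are locally integrable. -/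
def l1LocSubmodule : Submodule ℂ (ℝ≥0 →ₘ[leb] ℂ) where
  carrier := {f | LocallyIntegrable f leb}
  zero_mem' := by
    refine LocallyIntegrable.congr locallyIntegrable_zero ?_
    exact AEEqFun.coeFn_zero.symm
  add_mem' := fun {f g} hf hg =>
    LocallyIntegrable.congr (LocallyIntegrable.add hf hg) (AEEqFun.coeFn_add f g).symm
  smul_mem' := fun c f hf =>
    LocallyIntegrable.congr (LocallyIntegrable.smul hf c) (AEEqFun.coeFn_smul c f).symm

/-- The space `L¹_loc` of locally integrable functions on `ℝ⁺`, modulo null functions. -/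
def L1Loc : Type := ↥l1LocSubmodule

instance : AddCommGroup L1Loc := inferInstanceAs (AddCommGroup ↥l1LocSubmodule)
instance : Module ℂ L1Loc := inferInstanceAs (Module ℂ ↥l1LocSubmodule)

namespace L1Loc

theorem locallyIntegrable_iff {f : ℝ≥0 → ℂ} :
    LocallyIntegrable f leb ↔ ∀ n : ℕ, IntegrableOn f (Iio (n : ℝ≥0)) leb := by
  constructor
  · intro h n
    exact (h.integrableOn_isCompact isCompact_Icc).mono_set 
      fun x (hx : x < n) => (⟨zero_le, hx.le⟩ : x ∈ Icc 0 (n : ℝ≥0))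
  · intro h x
    obtain ⟨n, hn⟩ := exists_nat_gt x
    exact ⟨Iio n, Iio_mem_nhds hn, h n⟩

/-- A representative of an element of `L¹_loc`. -/
def fn (f : L1Loc) : ℝ≥0 → ℂ := (f.1 : ℝ≥0 →ₘ[leb] ℂ)

theorem stronglyMeasurable_fn (f : L1Loc) : StronglyMeasurable f.fn := AEEqFun.stronglyMeasurable _

theorem locallyIntegrable_fn (f : L1Loc) : LocallyIntegrable f.fn leb := f.2

theorem integrableOn_fn (f : L1Loc) (n : ℕ) : IntegrableOn f.fn (Iio (n : ℝ≥0)) leb :=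
  locallyIntegrable_iff.1 f.2 n

/-- The class of a locally integrable function. -/
def mk (f : ℝ≥0 → ℂ) (hf : LocallyIntegrable f leb) : L1Loc :=
  ⟨AEEqFun.mk f hf.aestronglyMeasurable, hf.congr (AEEqFun.coeFn_mk _ _).symm⟩

theorem fn_mk (f : ℝ≥0 → ℂ) (hf : LocallyIntegrable f leb) : (mk f hf).fn =ᵐ[leb] f :=
  AEEqFun.coeFn_mk _ _

theorem fn_add (f g : L1Loc) : (f + g).fn =ᵐ[leb] fun x => f.fn x + g.fn x :=
  AEEqFun.coeFn_add f.1 g.1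

theorem fn_smul (c : ℂ) (f : L1Loc) : (c • f).fn =ᵐ[leb] fun x => c * f.fn x :=
  AEEqFun.coeFn_smul c f.1

theorem ext {f g : L1Loc} (h : f.fn =ᵐ[leb] g.fn) : f = g := Subtype.ext (AEEqFun.ext h)

/-- The seminorm `f ↦ ‖R_n f‖ = ∫_0^n |f(t)| dt`. -/
def seminorm (n : ℕ) : Seminorm ℂ L1Loc :=
  Seminorm.of (fun f => ∫ x in Iio (n : ℝ≥0), ‖f.fn x‖ ∂leb)
    (fun f g => by
      rw [← integral_add (f.integrableOn_fn n).norm (g.integrableOn_fn n).norm]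
      apply integral_mono_ae ((f + g).integrableOn_fn n).norm
        ((f.integrableOn_fn n).norm.add (g.integrableOn_fn n).norm)
      filter_upwards [ae_restrict_of_ae (fn_add f g)] with x hx
      rw [hx]
      exact norm_add_le _ _)
    (fun c f => by
      rw [← integral_const_mul]
      apply integral_congr_ae
      filter_upwards [ae_restrict_of_ae (fn_smul c f)] with x hx
      rw [hx, norm_mul])

/-- The topology of `L¹_loc`, given by the seminorms `f ↦ ‖R_n f‖`. -/
instance : TopologicalSpace L1Loc := (SeminormFamily.moduleFilterBasis (𝕜 := ℂ) seminorm).topology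

theorem withSeminorms : WithSeminorms (𝕜 := ℂ) seminorm := ⟨rfl⟩

instance : IsTopologicalAddGroup L1Loc := withSeminorms.topologicalAddGroup
instance : ContinuousSMul ℂ L1Loc := withSeminorms.continuousSMul

theorem locallyIntegrable_X (f : L1Loc) :
    LocallyIntegrable (fun x : ℝ≥0 => ((x : ℝ) : ℂ) * f.fn x) leb := by
  rw [locallyIntegrable_iff]
  intro n
  refine Integrable.bdd_mul (c := n) (f.integrableOn_fn n) ?_ ?_
  · exact (Complex.continuous_ofReal.comp NNReal.continuous_coe).aestronglyMeasurable
  · filter_upwards [ae_restrict_mem measurableSet_Iio] with x hx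
    have : (x : ℝ) ≤ n := by exact_mod_cast le_of_lt hx
    simpa using this

/-- The operator `X` on `L¹_loc`: `(Xf)(t) = t f(t)`. -/
def X : L1Loc →ₗ[ℂ] L1Loc where
  toFun f := mk (fun x : ℝ≥0 => ((x : ℝ) : ℂ) * f.fn x) (locallyIntegrable_X f)
  map_add' f g := by
    apply ext
    filter_upwards [fn_mk _ (locallyIntegrable_X (f + g)), fn_mk _ (locallyIntegrable_X f),
      fn_mk _ (locallyIntegrable_X g), fn_add f g,
      fn_add (mk _ (locallyIntegrable_X f)) (mk _ (locallyIntegrable_X g))] with x h1 h2 h3 h4 h5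
    rw [h1, h5, h2, h3, h4, mul_add]
  map_smul' c f := by
    apply ext
    filter_upwards [fn_mk _ (locallyIntegrable_X (c • f)), fn_mk _ (locallyIntegrable_X f),
      fn_smul c f, fn_smul c (mk _ (locallyIntegrable_X f))] with x h1 h2 h3 h4
    rw [RingHom.id_apply, h1, h4, h2, h3]
    ring

/-- The convolution of a function and a locally finite measure,
`(g * μ)(t) = ∫_{[0,t]} g(t - s) dμ(s)`; the integral over `[0, t]` only involves the restriction
of `μ` to `[0, n)` where `n` is any integer with `n > t`. -/
def convFun (g : ℝ≥0 → ℂ) (μ : MLoc) (t : ℝ≥0) : ℂ :=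
  ∫ᵛ s in Iic t, g (t - s) ∂[mulC; MLoc.restr (⌊t⌋₊ + 1) μ]

theorem convFun_eq (g : ℝ≥0 → ℂ) (μ : MLoc) {t : ℝ≥0} {n : ℕ} (ht : t < n) :
    convFun g μ t = ∫ᵛ s, (Iic t).indicator (fun s => g (t - s)) s ∂[mulC; MLoc.restr n μ] := by
  rw [convFun, VectorMeasure.integral_indicator measurableSet_Iic]
  congr 1
  apply MLoc.restrict_restr
  · intro s hs
    exact lt_of_le_of_lt hs (by exact_mod_cast Nat.lt_floor_add_one t)
  · exact fun s hs => lt_of_le_of_lt hs ht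

theorem stronglyMeasurable_kernel {g : ℝ≥0 → ℂ} (hg : StronglyMeasurable g) :
    StronglyMeasurable fun p : ℝ≥0 × ℝ≥0 => (Iic p.1).indicator (fun s => g (p.1 - s)) p.2 := by
  have h : (fun p : ℝ≥0 × ℝ≥0 => (Iic p.1).indicator (fun s => g (p.1 - s)) p.2) =
      {p : ℝ≥0 × ℝ≥0 | p.2 ≤ p.1}.indicator fun p => g (p.1 - p.2) := by
    ext p
    by_cases hp : p.2 ≤ p.1 <;> simp [hp]
  rw [h]
  exact (hg.comp_measurable (measurable_fst.sub measurable_snd)).indicator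
    (measurableSet_le measurable_snd measurable_fst)

/-- Young's inequality on `[0, n)`, for the kernel `(t, s) ↦ g (t - s)`. -/
theorem lintegral_kernel_le {g : ℝ≥0 → ℂ} (hg : StronglyMeasurable g) (n : ℕ) (s : ℝ≥0) :
    ∫⁻ t in Iio (n : ℝ≥0), ‖(Iic t).indicator (fun s => g (t - s)) s‖ₑ ∂leb ≤
      ∫⁻ x in Iio (n : ℝ≥0), ‖g x‖ₑ ∂leb := by
  have hF : Measurable ((Iio (n : ℝ≥0)).indicator fun x => ‖g x‖ₑ) :=
    hg.enorm.indicator measurableSet_Iio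
  rw [← lintegral_indicator measurableSet_Iio, ← lintegral_indicator measurableSet_Iio,
    ← lintegral_Ici_sub s hF, ← lintegral_indicator measurableSet_Ici]
  apply lintegral_mono
  intro t
  by_cases hst : s ≤ t
  · by_cases htn : t < n
    · have : t - s < n := lt_of_le_of_lt tsub_le_self htn
      simp [hst, htn, this]
    · simp [htn]
  · simp [hst]

instance : SFinite leb := by
  have : SigmaFinite leb := inferInstance
  infer_instance

theorem lintegral_lintegral_kernel_le {g : ℝ≥0 → ℂ} (hg : StronglyMeasurable g) (n : ℕ)
    (ρ : Measure ℝ≥0) [IsFiniteMeasure ρ] :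
    ∫⁻ t in Iio (n : ℝ≥0), ∫⁻ s, ‖(Iic t).indicator (fun s => g (t - s)) s‖ₑ ∂ρ ∂leb ≤
      ρ univ * ∫⁻ x in Iio (n : ℝ≥0), ‖g x‖ₑ ∂leb := by
  rw [lintegral_lintegral_swap (stronglyMeasurable_kernel hg).enorm.aemeasurable]
  calc _ ≤ ∫⁻ _, ∫⁻ x in Iio (n : ℝ≥0), ‖g x‖ₑ ∂leb ∂ρ :=
        lintegral_mono fun s => lintegral_kernel_le hg n s
    _ = _ := by rw [lintegral_const, mul_comm]

theorem ae_integrable_kernel {g : ℝ≥0 → ℂ} (hg : StronglyMeasurable g)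
    (hgi : LocallyIntegrable g leb) (μ : MLoc) (n : ℕ) :
    ∀ᵐ t ∂leb.restrict (Iio (n : ℝ≥0)), (MLoc.restr n μ).Integrable
      ((Iic t).indicator fun s => g (t - s)) := by
  have h1 := lintegral_lintegral_kernel_le hg n (MLoc.restr n μ).variation
  have h2 := (locallyIntegrable_iff.1 hgi n).2
  have h3 := (h1.trans_lt (ENNReal.mul_lt_top (measure_lt_top _ _) h2)).ne
  have h4 := ae_lt_top' ((stronglyMeasurable_kernel hg).enorm.lintegral_prod_right').aemeasurable h3
  filter_upwards [h4] with t ht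
  exact ⟨((stronglyMeasurable_kernel hg).comp_measurable measurable_prodMk_left).aestronglyMeasurable,
    ht⟩

theorem lintegral_convFun_le {g : ℝ≥0 → ℂ} (hg : StronglyMeasurable g) (μ : MLoc) (n : ℕ) :
    ∫⁻ t in Iio (n : ℝ≥0), ‖convFun g μ t‖ₑ ∂leb ≤
      (MLoc.restr n μ).variation univ * ∫⁻ x in Iio (n : ℝ≥0), ‖g x‖ₑ ∂leb := by
  refine le_trans ?_ (lintegral_lintegral_kernel_le hg n (MLoc.restr n μ).variation)
  apply setLIntegral_mono' measurableSet_Iio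
  intro t ht
  rw [convFun_eq g μ ht]
  refine VectorMeasure.enorm_integral_le_lintegral_enorm.trans ?_
  have : ‖mulC‖ₑ = 1 := by
    rw [← ofReal_norm, ContinuousLinearMap.opNorm_mul]; simp
  rw [this, one_mul]

theorem aestronglyMeasurable_convFun {g : ℝ≥0 → ℂ} (hg : StronglyMeasurable g)
    (hgi : LocallyIntegrable g leb) (μ : MLoc) (n : ℕ) :
    AEStronglyMeasurable (convFun g μ) (leb.restrict (Iio (n : ℝ≥0))) := by
  have h0 := ae_integrable_kernel hg hgi μ n
  have h1 : ∀ t < (n : ℝ≥0), convFun g μ t =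
      ∫ᵛ s, (Iic t).indicator (fun s => g (t - s)) s ∂[mulC; MLoc.restr n μ] :=
    fun t ht => convFun_eq g μ ht
  obtain ⟨h, hh, hm⟩ := exists_density (MLoc.restr n μ)
  have hfin : IsFiniteMeasure (MLoc.restr n μ).variation := inferInstance
  generalize (MLoc.restr n μ).variation = ρ at hh hm hfin
  rw [← hm] at h0 h1
  have h2 : AEStronglyMeasurable (fun p : ℝ≥0 × ℝ≥0 =>
      (Iic p.1).indicator (fun s => g (p.1 - s)) p.2 * h p.2)
      ((leb.restrict (Iio (n : ℝ≥0))).prod ρ) :=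
    (stronglyMeasurable_kernel hg).aestronglyMeasurable.mul hh.1.comp_snd
  refine h2.integral_prod_right'.congr ?_
  filter_upwards [h0, ae_restrict_mem measurableSet_Iio] with t ht htn
  rw [h1 t htn, integral_withDensity hh ht]

theorem locallyIntegrable_convFun {g : ℝ≥0 → ℂ} (hg : StronglyMeasurable g)
    (hgi : LocallyIntegrable g leb) (μ : MLoc) : LocallyIntegrable (convFun g μ) leb := by
  rw [locallyIntegrable_iff]
  intro n
  exact ⟨aestronglyMeasurable_convFun hg hgi μ n, (lintegral_convFun_le hg μ n).trans_lt
    (ENNReal.mul_lt_top (measure_lt_top _ _) (locallyIntegrable_iff.1 hgi n).2)⟩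

theorem ae_of_forall_nat {P : ℝ≥0 → Prop}
    (h : ∀ n : ℕ, ∀ᵐ t ∂leb.restrict (Iio (n : ℝ≥0)), P t) : ∀ᵐ t ∂leb, P t := by
  have : (univ : Set ℝ≥0) = ⋃ n : ℕ, Iio (n : ℝ≥0) := by
    ext x
    simpa using exists_nat_gt x
  rw [← Measure.restrict_univ (μ := leb), this, ae_restrict_iUnion_iff]
  exact h

theorem convFun_add_ae {f g : ℝ≥0 → ℂ} (hf : StronglyMeasurable f) (hg : StronglyMeasurable g)
    (hfi : LocallyIntegrable f leb) (hgi : LocallyIntegrable g leb) (μ : MLoc) :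
    convFun (fun x => f x + g x) μ =ᵐ[leb] fun t => convFun f μ t + convFun g μ t := by
  apply ae_of_forall_nat
  intro n
  filter_upwards [ae_integrable_kernel hf hfi μ n, ae_integrable_kernel hg hgi μ n,
    ae_restrict_mem measurableSet_Iio] with t h1 h2 ht
  rw [convFun_eq _ μ ht, convFun_eq _ μ ht, convFun_eq _ μ ht, ← VectorMeasure.integral_add h1 h2]
  congr 1
  ext s
  by_cases hs : s ≤ t <;> simp [hs]

theorem convFun_smul_ae {f : ℝ≥0 → ℂ} (hf : StronglyMeasurable f)
    (hfi : LocallyIntegrable f leb) (c : ℂ) (μ : MLoc) :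
    convFun (fun x => c * f x) μ =ᵐ[leb] fun t => c * convFun f μ t := by
  apply ae_of_forall_nat
  intro n
  filter_upwards [ae_integrable_kernel hf hfi μ n,
    ae_restrict_mem measurableSet_Iio] with t h1 ht
  rw [convFun_eq _ μ ht, convFun_eq _ μ ht]
  obtain ⟨h, hh, hm⟩ := exists_density (MLoc.restr n μ)
  generalize (MLoc.restr n μ).variation = ρ at hh hm
  rw [← hm] at h1 ⊢
  rw [integral_withDensity hh h1]
  have h2 := Integrable.const_mul h1 c
  have h3 : (Iic t).indicator (fun s => c * f (t - s)) =
      fun s => c * (Iic t).indicator (fun s => f (t - s)) s := by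
    ext s; by_cases hs : s ≤ t <;> simp [hs]
  rw [h3, integral_withDensity hh h2, ← integral_const_mul]
  simp only [mul_assoc]

theorem convFun_congr_ae {f g : ℝ≥0 → ℂ} (hf : StronglyMeasurable f) (hg : StronglyMeasurable g)
    (hfi : LocallyIntegrable f leb) (hgi : LocallyIntegrable g leb) (μ : MLoc)
    (hfg : f =ᵐ[leb] g) : convFun f μ =ᵐ[leb] convFun g μ := by
  have h0 : ∀ n : ℕ, ∫⁻ x in Iio (n : ℝ≥0), ‖f x - g x‖ₑ ∂leb = 0 := by
    intro n
    rw [lintegral_congr_ae (g := 0), Pi.zero_def, lintegral_zero]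
    filter_upwards [ae_restrict_of_ae hfg] with x hx
    simp [hx]
  have h1 : convFun (fun x => f x - g x) μ =ᵐ[leb] 0 := by
    apply ae_of_forall_nat
    intro n
    have h2 := lintegral_convFun_le (hf.sub hg) μ n
    simp only [Pi.sub_apply, h0 n, mul_zero, nonpos_iff_eq_zero] at h2
    have h3 := aestronglyMeasurable_convFun (hf.sub hg) (hfi.sub hgi) μ n
    have h4 := (lintegral_eq_zero_iff' h3.enorm).1 h2
    filter_upwards [h4] with t ht
    exact enorm_eq_zero.1 ht
  have h2 := convFun_add_ae (hf.sub hg) hg (hfi.sub hgi) hgi μ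
  simp only [Pi.sub_apply, sub_add_cancel] at h2
  filter_upwards [h1, h2] with t ht1 ht2
  have ht1' : convFun (f - g) μ t = 0 := ht1
  rw [ht2, ht1', zero_add]

theorem locallyIntegrable_conv (μ : MLoc) (f : L1Loc) : LocallyIntegrable (convFun f.fn μ) leb :=
  locallyIntegrable_convFun f.stronglyMeasurable_fn f.locallyIntegrable_fn μ

/-- Convolution with `μ` on `L¹_loc`: `(f * μ)(t) = ∫_{[0,t]} f(t - s) dμ(s)`. -/
def conv (μ : MLoc) : L1Loc →ₗ[ℂ] L1Loc where
  toFun f := mk (convFun f.fn μ) (locallyIntegrable_conv μ f)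
  map_add' f g := by
    apply ext
    filter_upwards [fn_mk _ (locallyIntegrable_conv μ (f + g)), fn_mk _ (locallyIntegrable_conv μ f),
      fn_mk _ (locallyIntegrable_conv μ g),
      fn_add (mk _ (locallyIntegrable_conv μ f)) (mk _ (locallyIntegrable_conv μ g)),
      convFun_congr_ae (f + g).stronglyMeasurable_fn
        (f.stronglyMeasurable_fn.add g.stronglyMeasurable_fn) (f + g).locallyIntegrable_fn
        (f.locallyIntegrable_fn.add g.locallyIntegrable_fn) μ (fn_add f g),
      convFun_add_ae f.stronglyMeasurable_fn g.stronglyMeasurable_fn f.locallyIntegrable_fn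
        g.locallyIntegrable_fn μ] with t h1 h2 h3 h4 h5 h6
    rw [h1, h4, h2, h3, h5]
    exact h6
  map_smul' c f := by
    apply ext
    filter_upwards [fn_mk _ (locallyIntegrable_conv μ (c • f)), fn_mk _ (locallyIntegrable_conv μ f),
      fn_smul c (mk _ (locallyIntegrable_conv μ f)),
      convFun_congr_ae (c • f).stronglyMeasurable_fn
        (f.stronglyMeasurable_fn.const_smul c) (c • f).locallyIntegrable_fn
        (f.locallyIntegrable_fn.smul c) μ (fn_smul c f),
      convFun_smul_ae f.stronglyMeasurable_fn f.locallyIntegrable_fn c μ] with t h1 h2 h3 h4 h5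
    rw [RingHom.id_apply, h1, h3, h2, h4]
    exact h5

end L1Loc

/-! ### Derivations, Montel operators and absolute continuity -/

/-- The derivation `D_μ f = Xf * μ` on `L¹_loc`. -/
def D (μ : MLoc) : L1Loc →ₗ[ℂ] L1Loc := L1Loc.conv μ ∘ₗ L1Loc.X

/-- The extension `D̄_μ ν = Xν * μ` of `D_μ` to `M_loc`. -/
def Dbar (μ : MLoc) : MLoc →ₗ[ℂ] MLoc := MLoc.conv μ ∘ₗ MLoc.X

/-- `μ ∈ M_loc` is absolutely continuous (with respect to Lebesgue measure on `ℝ⁺`). -/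
def MLoc.IsAbsolutelyContinuous (μ : MLoc) : Prop :=
  ∀ s : Set ℝ≥0, MeasurableSet s → Bornology.IsBounded s → leb s = 0 → μ.val s = 0

section Montel

variable {E F : Type*} [AddCommGroup E] [Module ℂ E] [TopologicalSpace E]
  [AddCommGroup F] [Module ℂ F] [TopologicalSpace F]

/-- A linear operator is Montel if it maps bounded sets to relatively compact sets. -/
def IsMontel (T : E →ₗ[ℂ] F) : Prop :=
  ∀ B : Set E, Bornology.IsVonNBounded ℂ B → IsCompact (closure (T '' B))

/-- A linear operator is weakly Montel if it maps bounded sets to weakly relatively compact sets. -/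
def IsWeaklyMontel (T : E →ₗ[ℂ] F) : Prop :=
  ∀ B : Set E, Bornology.IsVonNBounded ℂ B → IsCompact (closure (toWeakSpace ℂ F '' (T '' B)))

end Montel

end LocConv

end

noncomputable section

open MeasureTheory Set Filter Topology
open scoped NNReal ENNReal

namespace LocConv

/-! ### Values, densities and commutativity of convolution on `M_loc` -/

theorem withDensityᵥ_restrict_apply {X : Type*} [MeasurableSpace X] {ρ : Measure X} {h : X → ℂ}
    (hh : Integrable h ρ) {s : Set X} (hs : MeasurableSet s) :
    (ρ.withDensityᵥ h).restrict s = (ρ.restrict s).withDensityᵥ h := by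
  ext t ht
  rw [VectorMeasure.restrict_apply _ hs ht, withDensityᵥ_apply hh (ht.inter hs),
    withDensityᵥ_apply hh.restrict ht, Measure.restrict_restrict ht]

namespace MLoc

theorem seminorm_apply (n : ℕ) (ν : MLoc) :
    seminorm n ν = (restr n ν).variation.real univ := rfl

theorem norm_val_le (ν : MLoc) {n : ℕ} {s : Set ℝ≥0} (hs : MeasurableSet s)
    (hn : s ⊆ Iio (n : ℝ≥0)) : ‖ν.val s‖ ≤ seminorm n ν := by
  rw [← restr_apply_of_subset ν hs hn, seminorm_apply]
  exact (VectorMeasure.norm_measure_le_variation (measure_ne_top _ _)).trans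
    (measureReal_mono (subset_univ _))

/-- Evaluation at a bounded Borel set, as a continuous linear functional on `M_loc`. -/
def evalCLM (s : Set ℝ≥0) (hs : MeasurableSet s) (hb : Bornology.IsBounded s) : MLoc →L[ℂ] ℂ where
  toFun ν := ν.val s
  map_add' _ _ := rfl
  map_smul' _ _ := rfl
  cont := by
    obtain ⟨n, hn⟩ := isBounded_iff.1 hb
    let L : MLoc →ₗ[ℂ] ℂ := ⟨⟨fun ν => ν.val s, fun _ _ => rfl⟩, fun _ _ => rfl⟩
    refine WithSeminorms.continuous_normedSpace_rng ℂ withSeminorms L ⟨{n}, 1, fun ν => ?_⟩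
    rw [Finset.sup_singleton, one_smul]
    exact norm_val_le ν hs hn

theorem ext_of_subset_Ico {μ ν : MLoc} (h : ∀ (k : ℕ) (s : Set ℝ≥0), MeasurableSet s →
    s ⊆ Ico (k : ℝ≥0) (k + 1) → μ.val s = ν.val s) : μ = ν := by
  apply ext
  intro s hs hb
  have hU : s = ⋃ k : ℕ, s ∩ Ico (k : ℝ≥0) (k + 1) := by
    rw [← inter_iUnion, eq_comm, inter_eq_left]
    intro x _
    exact mem_iUnion.2 ⟨⌊x⌋₊, Nat.floor_le zero_le, Nat.lt_floor_add_one x⟩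
  have hd : Pairwise (Function.onFun Disjoint fun k : ℕ => s ∩ Ico (k : ℝ≥0) (k + 1)) := by
    intro i j hij
    refine disjoint_left.2 fun x hx hy => hij ?_
    rw [← (Nat.floor_eq_iff zero_le).2 hx.2, ← (Nat.floor_eq_iff zero_le).2 hy.2]
  have hm : ∀ k : ℕ, MeasurableSet (s ∩ Ico (k : ℝ≥0) (k + 1)) := fun k => hs.inter measurableSet_Ico
  have h1 := μ.hasSum_val hm hd (hU ▸ hb)
  have h2 := ν.hasSum_val hm hd (hU ▸ hb)
  rw [← hU] at h1 h2
  refine h1.unique ?_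
  simpa only [h _ _ (hm _) inter_subset_right] using h2

theorem conv_val (μ ν : MLoc) {n : ℕ} {s : Set ℝ≥0} (hs : MeasurableSet s)
    (hn : s ⊆ Iio (n : ℝ≥0)) : (conv μ ν).val s = finConv (restr n ν) (restr n μ) s :=
  glue_val (fun n => finConv (restr n ν) (restr n μ))
    (fun _ _ _ hs hn hk => finConv_restr ν μ hs hn hk) hs hn

theorem finConv_comm (a b : ComplexMeasure ℝ≥0) : finConv a b = finConv b a := by
  have h : b.prod a mulC = (a.prod b mulC).map Prod.swap := by
    apply VectorMeasure.prod_eq_of_forall_apply_prod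
    intro s t hs ht
    rw [VectorMeasure.map_apply _ measurable_swap (hs.prod ht), preimage_swap_prod,
      VectorMeasure.prod_apply]
    simp [mul_comm]
  have hm : Measurable fun p : ℝ≥0 × ℝ≥0 => p.1 + p.2 := measurable_add
  ext s hs
  rw [finConv, finConv, h, VectorMeasure.map_apply _ hm hs, VectorMeasure.map_apply _ hm hs,
    VectorMeasure.map_apply _ measurable_swap (hm hs)]
  congr 1
  ext p
  simp [add_comm]

theorem conv_apply_comm (μ ν : MLoc) : conv μ ν = conv ν μ := by
  apply ext
  intro s hs hb
  obtain ⟨n, hn⟩ := isBounded_iff.1 hb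
  rw [conv_val _ _ hs hn, conv_val _ _ hs hn, finConv_comm]

theorem X_val (ν : MLoc) {n : ℕ} {s : Set ℝ≥0} (hs : MeasurableSet s) (hn : s ⊆ Iio (n : ℝ≥0)) :
    (X ν).val s = ∫ᵛ x in s, ((x : ℝ) : ℂ) ∂[mulC; restr n ν] := by
  rw [← VectorMeasure.withDensity_apply (integrable_id_restr n ν)]
  exact glue_val (fun n => (restr n ν).withDensity (fun x : ℝ≥0 => ((x : ℝ) : ℂ)) mulC)
    (fun n k s hs hn hk => by
      rw [VectorMeasure.withDensity_apply (integrable_id_restr n ν),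
        VectorMeasure.withDensity_apply (integrable_id_restr k ν), restrict_restr ν hn hk]) hs hn

theorem restr_X_of_density {n : ℕ} {ν : MLoc} {ρ : Measure ℝ≥0} {h : ℝ≥0 → ℂ}
    (hh : Integrable h ρ) (hν : ρ.withDensityᵥ h = restr n ν) :
    Integrable (fun x : ℝ≥0 => ((x : ℝ) : ℂ) * h x) ρ ∧
      restr n (X ν) = ρ.withDensityᵥ fun x : ℝ≥0 => ((x : ℝ) : ℂ) * h x := by
  have h1 := integrable_id_restr n ν
  rw [← hν] at h1
  have h2 := integrable_mul_density hh h1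
  refine ⟨h2, ?_⟩
  ext s hs
  have h3 : (restr n ν).restrict (s ∩ Iio (n : ℝ≥0)) = (restr n ν).restrict s := by
    ext t ht
    rw [VectorMeasure.restrict_apply _ (hs.inter measurableSet_Iio) ht,
      VectorMeasure.restrict_apply _ hs ht, restr_apply _ _ (ht.inter (hs.inter measurableSet_Iio)),
      restr_apply _ _ (ht.inter hs), inter_assoc, inter_assoc, inter_self, inter_assoc]
  have h4 : ((ρ.restrict s).withDensityᵥ h).Integrable (fun x : ℝ≥0 => ((x : ℝ) : ℂ)) := by
    rw [← withDensityᵥ_restrict_apply hh hs]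
    exact VectorMeasure.Integrable.restrict h1
  rw [restr_apply _ _ hs, X_val _ (hs.inter measurableSet_Iio) inter_subset_right,
    withDensityᵥ_apply h2 hs, h3, ← hν, withDensityᵥ_restrict_apply hh hs,
    integral_withDensity hh.restrict h4]

theorem seminorm_X_le (n : ℕ) (ν : MLoc) : seminorm n (X ν) ≤ n * seminorm n ν := by
  obtain ⟨h, hh, hm⟩ := exists_density (restr n ν)
  obtain ⟨h1, h2⟩ := restr_X_of_density hh hm
  have h3 : (restr n (X ν)).variation ≤ (n : ℝ≥0∞) • (restr n ν).variation := by
    conv_rhs => rw [← hm]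
    rw [h2, Measure.variation_withDensityᵥ h1, Measure.variation_withDensityᵥ hh,
      ← withDensity_smul' _ _ (by simp)]
    apply withDensity_mono
    have h4 : ∀ᵐ x ∂(restr n ν).variation, x ∈ Iio (n : ℝ≥0) := variation_restr_compl n ν
    filter_upwards [h4] with x hx
    rw [enorm_mul, Pi.smul_apply, smul_eq_mul]
    gcongr
    have : ‖((x : ℝ) : ℂ)‖ₑ = x := by simp [enorm_eq_nnnorm]
    rw [this]
    exact_mod_cast hx.le
  rw [seminorm_apply, seminorm_apply, measureReal_def, measureReal_def,
    ← ENNReal.toReal_natCast n, ← ENNReal.toReal_mul]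
  exact ENNReal.toReal_mono (ENNReal.mul_ne_top (by simp) (measure_ne_top _ _)) (h3 univ)

end MLoc

/-! ### The embedding of `L¹_loc` into `M_loc` -/

namespace L1Loc

theorem seminorm_apply (n : ℕ) (f : L1Loc) :
    seminorm n f = ∫ x in Iio (n : ℝ≥0), ‖f.fn x‖ ∂leb := rfl

/-- The locally finite measure with density `f ∈ L¹_loc`. -/
def toMLocFun (f : L1Loc) : MLoc :=
  MLoc.glue (fun n => (leb.restrict (Iio (n : ℝ≥0))).withDensityᵥ f.fn) (by
    intro n k s hs hn hk
    rw [withDensityᵥ_apply (f.integrableOn_fn n) hs, withDensityᵥ_apply (f.integrableOn_fn k) hs,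
      Measure.restrict_restrict hs, Measure.restrict_restrict hs, inter_eq_left.2 hn,
      inter_eq_left.2 hk])

theorem val_toMLocFun (f : L1Loc) {s : Set ℝ≥0} (hs : MeasurableSet s)
    (hb : Bornology.IsBounded s) : (toMLocFun f).val s = ∫ x in s, f.fn x ∂leb := by
  obtain ⟨n, hn⟩ := MLoc.isBounded_iff.1 hb
  rw [toMLocFun, MLoc.glue_val _ _ hs hn, withDensityᵥ_apply (f.integrableOn_fn n) hs,
    Measure.restrict_restrict hs, inter_eq_left.2 hn]

theorem integrableOn_fn_of_isBounded (f : L1Loc) {s : Set ℝ≥0} (hb : Bornology.IsBounded s) :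
    IntegrableOn f.fn s leb := by
  obtain ⟨n, hn⟩ := MLoc.isBounded_iff.1 hb
  exact (f.integrableOn_fn n).mono_set hn

/-- The embedding of `L¹_loc` into `M_loc` that sends a function to the measure with that
density. -/
def toMLoc : L1Loc →ₗ[ℂ] MLoc where
  toFun := toMLocFun
  map_add' f g := by
    apply MLoc.ext
    intro s hs hb
    rw [MLoc.val_add, val_toMLocFun _ hs hb, val_toMLocFun _ hs hb, val_toMLocFun _ hs hb,
      ← integral_add (f.integrableOn_fn_of_isBounded hb) (g.integrableOn_fn_of_isBounded hb)]
    exact integral_congr_ae (ae_restrict_of_ae (fn_add f g))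
  map_smul' c f := by
    apply MLoc.ext
    intro s hs hb
    rw [RingHom.id_apply, MLoc.val_smul, val_toMLocFun _ hs hb, val_toMLocFun _ hs hb,
      ← integral_const_mul]
    exact integral_congr_ae (ae_restrict_of_ae (fn_smul c f))

theorem val_toMLoc (f : L1Loc) {s : Set ℝ≥0} (hs : MeasurableSet s)
    (hb : Bornology.IsBounded s) : (toMLoc f).val s = ∫ x in s, f.fn x ∂leb :=
  val_toMLocFun f hs hb

theorem restr_toMLoc (n : ℕ) (f : L1Loc) :
    MLoc.restr n (toMLoc f) = (leb.restrict (Iio (n : ℝ≥0))).withDensityᵥ f.fn := by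
  ext s hs
  rw [MLoc.restr_apply _ _ hs, val_toMLoc _ (hs.inter measurableSet_Iio)
    ((MLoc.isBounded_Iio _).subset inter_subset_right),
    withDensityᵥ_apply (f.integrableOn_fn n) hs, Measure.restrict_restrict hs]

theorem seminorm_toMLoc (n : ℕ) (f : L1Loc) : MLoc.seminorm n (toMLoc f) = seminorm n f := by
  rw [MLoc.seminorm_apply, restr_toMLoc, Measure.variation_withDensityᵥ (f.integrableOn_fn n),
    measureReal_def, withDensity_apply _ MeasurableSet.univ, Measure.restrict_univ,
    seminorm_apply, integral_norm_eq_lintegral_enorm (f.integrableOn_fn n).1]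

/-- The embedding of `L¹_loc` into `M_loc` as a continuous linear map. -/
def toMLocCLM : L1Loc →L[ℂ] MLoc where
  toLinearMap := toMLoc
  cont := by
    refine MLoc.withSeminorms.continuous_of_continuous_comp _ fun n => ?_
    have : (MLoc.seminorm n).comp toMLoc = seminorm n := by
      ext f
      exact seminorm_toMLoc n f
    rw [this]
    exact withSeminorms.continuous_seminorm n

theorem toMLoc_injective : Function.Injective toMLoc := by
  intro f g hfg
  apply ext
  apply ae_of_forall_nat
  intro n
  apply (f.integrableOn_fn n).ae_eq_of_withDensityᵥ_eq (g.integrableOn_fn n)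
  rw [← restr_toMLoc, ← restr_toMLoc, hfg]

theorem X_toMLoc (f : L1Loc) : MLoc.X (toMLoc f) = toMLoc (X f) := by
  apply MLoc.ext
  intro s hs hb
  obtain ⟨n, hn⟩ := MLoc.isBounded_iff.1 hb
  obtain ⟨h1, h2⟩ := MLoc.restr_X_of_density (f.integrableOn_fn n) (restr_toMLoc n f).symm
  rw [← MLoc.restr_apply_of_subset _ hs hn, ← MLoc.restr_apply_of_subset _ hs hn, h2, restr_toMLoc,
    WithDensityᵥEq.congr_ae]
  exact EventuallyEq.symm (ae_restrict_of_ae (fn_mk _ (locallyIntegrable_X f)))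

end L1Loc

/-! ### Convolution of a measure with an absolutely continuous measure -/

namespace L1Loc

theorem conv_toMLoc_val (μ : MLoc) (g : L1Loc) {n : ℕ} {s : Set ℝ≥0} (hs : MeasurableSet s)
    (hn : s ⊆ Iio (n : ℝ≥0)) : (MLoc.conv μ (toMLoc g)).val s =
      ∫ x in Iio (n : ℝ≥0), MLoc.restr n μ ((fun y => x + y) ⁻¹' s) * g.fn x ∂leb := by
  have hm : Measurable fun p : ℝ≥0 × ℝ≥0 => p.1 + p.2 := measurable_add
  rw [MLoc.conv_val _ _ hs hn, MLoc.finConv_apply _ _ hs, restr_toMLoc,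
    integral_withDensity (g.integrableOn_fn n)]
  have := VectorMeasure.integrable_vectorMeasure_prodMk_left (μ := MLoc.restr n (toMLoc g))
    (ν := MLoc.restr n μ) (hm hs)
  rw [restr_toMLoc] at this
  exact this

theorem integral_kernel_eq {g : ℝ≥0 → ℂ} (hg : StronglyMeasurable g) {n : ℕ} {s : Set ℝ≥0}
    (hs : MeasurableSet s) (hn : s ⊆ Iio (n : ℝ≥0)) (y : ℝ≥0) :
    ∫ t in s, (Iic t).indicator (fun y => g (t - y)) y ∂leb =
      ∫ x in Iio (n : ℝ≥0), ((fun x => x + y) ⁻¹' s).indicator g x ∂leb := by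
  have h1 : ∀ t, (Iic t).indicator (fun y => g (t - y)) y =
      (Ici y).indicator (fun t => g (t - y)) t := by
    intro t
    by_cases h : y ≤ t <;> simp [h]
  have hmeas : StronglyMeasurable (s.indicator fun t => g (t - y)) :=
    (hg.comp_measurable (measurable_id.sub_const y)).indicator hs
  simp only [h1]
  rw [setIntegral_indicator measurableSet_Ici, inter_comm, ← setIntegral_indicator hs,
    ← map_add_leb, integral_map (by fun_prop) hmeas.aestronglyMeasurable,
    setIntegral_eq_integral_of_forall_compl_eq_zero]
  · congr 1
    ext x
    by_cases h : x + y ∈ s <;> simp [h]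
  · intro x hx
    rw [indicator_of_notMem]
    exact fun h => hx (mem_Iio.2 (lt_of_le_of_lt le_self_add (mem_Iio.1 (hn h))))

theorem integrable_kernel_mul {g : ℝ≥0 → ℂ} (hg : StronglyMeasurable g)
    (hgi : LocallyIntegrable g leb) (n : ℕ) {ρ : Measure ℝ≥0} [SFinite ρ] {h : ℝ≥0 → ℂ}
    (hh : Integrable h ρ) :
    Integrable (fun p : ℝ≥0 × ℝ≥0 => (Iic p.1).indicator (fun s => g (p.1 - s)) p.2 * h p.2)
      ((leb.restrict (Iio (n : ℝ≥0))).prod ρ) := by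
  have hmeas : AEStronglyMeasurable
      (fun p : ℝ≥0 × ℝ≥0 => (Iic p.1).indicator (fun s => g (p.1 - s)) p.2 * h p.2)
      ((leb.restrict (Iio (n : ℝ≥0))).prod ρ) :=
    (stronglyMeasurable_kernel hg).aestronglyMeasurable.mul hh.1.comp_snd
  refine ⟨hmeas, ?_⟩
  rw [HasFiniteIntegral, lintegral_prod_symm _ hmeas.enorm]
  simp only [enorm_mul]
  calc _ ≤ ∫⁻ y, (∫⁻ x in Iio (n : ℝ≥0), ‖g x‖ₑ ∂leb) * ‖h y‖ₑ ∂ρ := by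
        apply lintegral_mono
        intro y
        dsimp only
        rw [lintegral_mul_const]
        · exact mul_le_mul' (lintegral_kernel_le hg n y) le_rfl
        · exact ((stronglyMeasurable_kernel hg).comp_measurable
            (measurable_id.prodMk measurable_const)).enorm
    _ = (∫⁻ x in Iio (n : ℝ≥0), ‖g x‖ₑ ∂leb) * ∫⁻ y, ‖h y‖ₑ ∂ρ :=
        lintegral_const_mul'' _ hh.1.enorm
    _ < ∞ := ENNReal.mul_lt_top (locallyIntegrable_iff.1 hgi n).2 hh.2

theorem conv_toMLoc (μ : MLoc) (g : L1Loc) : MLoc.conv μ (toMLoc g) = toMLoc (conv μ g) := by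
  apply MLoc.ext
  intro s hs hb
  obtain ⟨n, hn⟩ := MLoc.isBounded_iff.1 hb
  obtain ⟨h, hh, hm⟩ := exists_density (MLoc.restr n μ)
  have h0 := ae_integrable_kernel g.stronglyMeasurable_fn g.locallyIntegrable_fn μ n
  have h1 : ∀ t ∈ s, convFun g.fn μ t =
      ∫ᵛ s, (Iic t).indicator (fun s => g.fn (t - s)) s ∂[mulC; MLoc.restr n μ] :=
    fun t ht => convFun_eq g.fn μ (hn ht)
  have hfin : IsFiniteMeasure (MLoc.restr n μ).variation := inferInstance
  rw [conv_toMLoc_val μ g hs hn, val_toMLoc _ hs hb]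
  generalize (MLoc.restr n μ).variation = ρ at hh hm hfin
  rw [← hm] at h0 h1 ⊢
  have hmeas : Measurable fun p : ℝ≥0 × ℝ≥0 => p.1 + p.2 := measurable_add
  have hms : ∀ x : ℝ≥0, MeasurableSet ((fun y => x + y) ⁻¹' s) := fun x =>
    (measurable_const_add x) hs
  have e1 : ∫ t in s, (conv μ g).fn t ∂leb =
      ∫ t in s, ∫ y, (Iic t).indicator (fun y => g.fn (t - y)) y * h y ∂ρ ∂leb := by
    apply integral_congr_ae
    filter_upwards [ae_restrict_of_ae (fn_mk _ (locallyIntegrable_conv μ g)),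
      ae_restrict_of_ae_restrict_of_subset hn h0, ae_restrict_mem hs] with t h2 h3 h4
    rw [← integral_withDensity hh h3, ← h1 t h4]
    exact h2
  have i1 : Integrable
      (fun p : ℝ≥0 × ℝ≥0 => (Iic p.1).indicator (fun s => g.fn (p.1 - s)) p.2 * h p.2)
      ((leb.restrict s).prod ρ) :=
    (integrable_kernel_mul g.stronglyMeasurable_fn g.locallyIntegrable_fn n hh).mono_measure
      (Measure.prod_mono (Measure.restrict_mono hn le_rfl) le_rfl)
  have i2 : Integrable (fun p : ℝ≥0 × ℝ≥0 =>
      ((fun p : ℝ≥0 × ℝ≥0 => p.1 + p.2) ⁻¹' s).indicator (fun p => g.fn p.1 * h p.2) p)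
      ((leb.restrict (Iio (n : ℝ≥0))).prod ρ) :=
    ((g.integrableOn_fn n).mul_prod hh).indicator (hmeas hs)
  rw [e1, integral_integral_swap i1]
  calc _ = ∫ x in Iio (n : ℝ≥0), ∫ y, ((fun p : ℝ≥0 × ℝ≥0 => p.1 + p.2) ⁻¹' s).indicator
        (fun p => g.fn p.1 * h p.2) (x, y) ∂ρ ∂leb := by
        congr 1
        ext x
        rw [withDensityᵥ_apply hh (hms x), ← integral_indicator (hms x), ← integral_mul_const]
        congr 1
        ext y
        by_cases hxy : x + y ∈ s <;> simp [hxy, mul_comm]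
    _ = ∫ y, ∫ x in Iio (n : ℝ≥0), ((fun p : ℝ≥0 × ℝ≥0 => p.1 + p.2) ⁻¹' s).indicator
        (fun p => g.fn p.1 * h p.2) (x, y) ∂leb ∂ρ := integral_integral_swap i2
    _ = _ := by
        congr 1
        ext y
        rw [integral_mul_const, integral_kernel_eq g.stronglyMeasurable_fn hs hn,
          ← integral_mul_const]
        congr 1
        ext x
        by_cases hxy : x + y ∈ s <;> simp [hxy]

theorem Iio_eq_iUnion_Ico (n : ℕ) :
    Iio (n : ℝ≥0) = ⋃ k ∈ Finset.range n, Ico (k : ℝ≥0) (k + 1) := by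
  ext t
  simp only [mem_Iio, mem_iUnion, Finset.mem_range, exists_prop]
  constructor
  · exact fun ht => ⟨⌊t⌋₊, (Nat.floor_lt zero_le).2 ht, Nat.floor_le zero_le,
      Nat.lt_floor_add_one t⟩
  · rintro ⟨k, hk, ht⟩
    have : (k : ℝ≥0) + 1 ≤ n := by exact_mod_cast hk
    exact ht.2.trans_le this

theorem locallyIntegrable_of_integrableOn_Ico {f : ℝ≥0 → ℂ}
    (hf : ∀ k : ℕ, IntegrableOn f (Ico (k : ℝ≥0) (k + 1)) leb) : LocallyIntegrable f leb := by
  rw [locallyIntegrable_iff]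
  intro n
  rw [Iio_eq_iUnion_Ico]
  exact integrableOn_finset_iUnion.2 fun k _ => hf k

end L1Loc

/-! ### Absolutely continuous measures have densities -/

theorem exists_density_of_absolutelyContinuous {X : Type*} [MeasurableSpace X] {ρ : Measure X}
    [SigmaFinite ρ] {m : ComplexMeasure X} (hm : m ≪ᵥ ρ.toENNRealVectorMeasure) :
    ∃ r : X → ℂ, Integrable r ρ ∧ ρ.withDensityᵥ r = m := by
  rw [ComplexMeasure.absolutelyContinuous_ennreal_iff] at hm
  have hr := SignedMeasure.withDensityᵥ_rnDeriv_eq _ _ hm.1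
  have hi := SignedMeasure.withDensityᵥ_rnDeriv_eq _ _ hm.2
  have ir := SignedMeasure.integrable_rnDeriv (ComplexMeasure.re m) ρ
  have ii := SignedMeasure.integrable_rnDeriv (ComplexMeasure.im m) ρ
  have hint : Integrable (fun x => ((ComplexMeasure.re m).rnDeriv ρ x : ℂ) +
      ((ComplexMeasure.im m).rnDeriv ρ x : ℂ) * Complex.I) ρ :=
    ir.ofReal.add (ii.ofReal.mul_const _)
  refine ⟨_, hint, ?_⟩
  ext s hs
  have ir' : Integrable (fun x => ((ComplexMeasure.re m).rnDeriv ρ x : ℂ)) (ρ.restrict s) :=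
    ir.ofReal.restrict
  have ii' : Integrable (fun x => ((ComplexMeasure.im m).rnDeriv ρ x : ℂ) * Complex.I)
      (ρ.restrict s) := (ii.ofReal.mul_const _).restrict
  rw [withDensityᵥ_apply hint hs, integral_add ir' ii', integral_mul_const,
    integral_complex_ofReal, integral_complex_ofReal]
  rw [← withDensityᵥ_apply ir hs, ← withDensityᵥ_apply ii hs, hr, hi]
  exact Complex.re_add_im _

theorem MLoc.IsAbsolutelyContinuous.exists_toMLoc_eq {μ : MLoc} (hμ : μ.IsAbsolutelyContinuous) :
    ∃ h : L1Loc, L1Loc.toMLoc h = μ := by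
  have h1 : ∀ n : ℕ, ∃ r : ℝ≥0 → ℂ, Integrable r leb ∧ leb.withDensityᵥ r = MLoc.restr n μ := by
    intro n
    have h2 : MLoc.restr n μ ≪ᵥ leb.toENNRealVectorMeasure := by
      intro s hs
      by_cases hms : MeasurableSet s
      · rw [Measure.toENNRealVectorMeasure_apply_measurable hms] at hs
        rw [MLoc.restr_apply _ _ hms]
        exact hμ _ (hms.inter measurableSet_Iio) ((MLoc.isBounded_Iio _).subset inter_subset_right)
          (measure_mono_null inter_subset_left hs)
      · exact VectorMeasure.not_measurable _ hms
    exact exists_density_of_absolutelyContinuous h2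
  choose r hr hrμ using h1
  have hEq : ∀ k : ℕ, EqOn (fun t : ℝ≥0 => r (⌊t⌋₊ + 1) t) (r (k + 1)) (Ico (k : ℝ≥0) (k + 1)) := by
    intro k t ht
    have : ⌊t⌋₊ = k := (Nat.floor_eq_iff zero_le).2 ht
    simp only [this]
  have hI : ∀ k : ℕ, IntegrableOn (fun t : ℝ≥0 => r (⌊t⌋₊ + 1) t) (Ico (k : ℝ≥0) (k + 1)) leb :=
    fun k => (hr (k + 1)).integrableOn.congr_fun (hEq k).symm measurableSet_Ico
  have hloc : LocallyIntegrable (fun t : ℝ≥0 => r (⌊t⌋₊ + 1) t) leb :=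
    L1Loc.locallyIntegrable_of_integrableOn_Ico hI
  refine ⟨L1Loc.mk _ hloc, MLoc.ext_of_subset_Ico fun k s hs hk => ?_⟩
  have hk' : s ⊆ Iio ((k + 1 : ℕ) : ℝ≥0) := fun x hx => by
    push_cast
    exact (hk hx).2
  rw [L1Loc.val_toMLoc _ hs (MLoc.isBounded_iff.2 ⟨k + 1, hk'⟩),
    ← MLoc.restr_apply_of_subset μ hs hk', ← hrμ, withDensityᵥ_apply (hr _) hs]
  rw [integral_congr_ae (ae_restrict_of_ae (L1Loc.fn_mk _ hloc))]
  exact setIntegral_congr_fun hs ((hEq k).mono hk)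

section Montel

variable {E F : Type*} [AddCommGroup E] [Module ℂ E] [TopologicalSpace E]
  [AddCommGroup F] [Module ℂ F] [TopologicalSpace F]

theorem IsMontel.isWeaklyMontel [IsTopologicalAddGroup F] [ContinuousSMul ℂ F] {T : E →ₗ[ℂ] F}
    (hT : IsMontel T) : IsWeaklyMontel T := fun B hB =>
  ((hT B hB).image (toWeakSpaceCLM ℂ F).continuous).closure_of_subset
    (image_mono subset_closure)

end Montel

theorem Dbar_toMLoc (μ : MLoc) (f : L1Loc) :
    Dbar μ (L1Loc.toMLoc f) = L1Loc.toMLoc (D μ f) := by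
  change MLoc.conv μ (MLoc.X (L1Loc.toMLoc f)) = L1Loc.toMLoc (L1Loc.conv μ (L1Loc.X f))
  rw [L1Loc.X_toMLoc, L1Loc.conv_toMLoc]

theorem isCompact_closure_of_isWeaklyMontel_D {μ : MLoc} (h : IsWeaklyMontel (D μ)) {B : Set L1Loc}
    (hB : Bornology.IsVonNBounded ℂ B) :
    IsCompact (closure (toWeakSpace ℂ MLoc '' (Dbar μ '' (L1Loc.toMLoc '' B)))) := by
  refine ((h B hB).image (WeakSpace.map L1Loc.toMLocCLM).continuous).closure_of_subset ?_
  rintro _ ⟨_, ⟨_, ⟨f, hf, rfl⟩, rfl⟩, rfl⟩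
  rw [Dbar_toMLoc]
  exact ⟨_, subset_closure ⟨_, ⟨f, hf, rfl⟩, rfl⟩, rfl⟩

theorem isVonNBounded_image_toMLoc {B : Set L1Loc} (hB : Bornology.IsVonNBounded ℂ B) :
    Bornology.IsVonNBounded ℂ (L1Loc.toMLoc '' B) :=
  hB.image L1Loc.toMLocCLM

/-- The normalised indicator function of `[1, 1 + 1/(k+1)]`. -/
def bumpFun (k : ℕ) : ℝ≥0 → ℂ := (Icc (1 : ℝ≥0) (1 + ((k : ℝ≥0) + 1)⁻¹)).indicator fun _ => (k : ℂ) + 1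

theorem leb_Icc_bump (k : ℕ) :
    leb.real (Icc (1 : ℝ≥0) (1 + ((k : ℝ≥0) + 1)⁻¹)) = ((k : ℝ) + 1)⁻¹ := by
  have : (0 : ℝ) ≤ ((k : ℝ) + 1)⁻¹ := by positivity
  rw [measureReal_def, leb_Icc]
  push_cast
  rw [add_sub_cancel_left, ENNReal.toReal_ofReal this]

theorem integrable_bumpFun (k : ℕ) : Integrable (bumpFun k) leb := by
  refine (integrable_indicator_iff measurableSet_Icc).2 (integrableOn_const ?_)
  rw [leb_Icc]
  exact ENNReal.ofReal_ne_top

/-- The element of `L¹_loc` given by the normalised indicator function of `[1, 1 + 1/(k+1)]`. -/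
def bump (k : ℕ) : L1Loc := L1Loc.mk (bumpFun k) (integrable_bumpFun k).locallyIntegrable

theorem isVonNBounded_range_bump : Bornology.IsVonNBounded ℂ (range bump) := by
  rw [L1Loc.withSeminorms.isVonNBounded_iff_seminorm_bounded]
  refine fun n => ⟨2, two_pos, ?_⟩
  rintro _ ⟨k, rfl⟩
  have hk : (0 : ℝ) < (k : ℝ) + 1 := by positivity
  have h1 : L1Loc.seminorm n (bump k) ≤ ∫ x, ‖bumpFun k x‖ ∂leb := by
    rw [L1Loc.seminorm_apply, integral_congr_ae (g := fun x => ‖bumpFun k x‖)]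
    · exact setIntegral_le_integral (integrable_bumpFun k).norm
        (Eventually.of_forall fun x => norm_nonneg _)
    · filter_upwards [ae_restrict_of_ae (L1Loc.fn_mk _ (integrable_bumpFun k).locallyIntegrable)]
        with x hx
      exact congrArg norm hx
  refine h1.trans_lt ?_
  have h2 : (fun x => ‖bumpFun k x‖) =
      (Icc (1 : ℝ≥0) (1 + ((k : ℝ≥0) + 1)⁻¹)).indicator fun _ => (k : ℝ) + 1 := by
    ext x
    rw [bumpFun, norm_indicator_eq_indicator_norm]
    congr 1
    ext
    have : ((k : ℂ) + 1) = (((k + 1 : ℕ) : ℝ) : ℂ) := by push_cast; ring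
    rw [this, Complex.norm_real]
    simp
    positivity
  rw [h2, integral_indicator measurableSet_Icc, setIntegral_const, leb_Icc_bump, smul_eq_mul,
    inv_mul_cancel₀ hk.ne']
  norm_num

theorem tendsto_integral_bumpFun_mul {Φ : ℝ≥0 → ℂ} (hm : StronglyMeasurable Φ) {L : ℂ}
    (hΦ : Tendsto Φ (𝓝[≥] 1) (𝓝 L)) :
    Tendsto (fun k : ℕ => ∫ x, Φ x * bumpFun k x ∂leb) atTop (𝓝 L) := by
  rw [Metric.tendsto_atTop]
  intro ε hε
  have h1 := Metric.tendsto_nhds.1 hΦ (ε / 2) (half_pos hε)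
  obtain ⟨u, hu, hsub⟩ := mem_nhdsGE_iff_exists_Ico_subset.1 h1
  have hlim : Tendsto (fun k : ℕ => 1 + ((k : ℝ≥0) + 1)⁻¹) atTop (𝓝 1) := by
    have := (tendsto_one_div_add_atTop_nhds_zero_nat (𝕜 := ℝ≥0)).const_add 1
    simpa using this
  obtain ⟨N, hN⟩ := eventually_atTop.1 (hlim.eventually (gt_mem_nhds hu))
  refine ⟨N, fun k hk => ?_⟩
  have hk0 : (0 : ℝ) < (k : ℝ) + 1 := by positivity
  have hkC : (k : ℂ) + 1 ≠ 0 := by exact_mod_cast Nat.succ_ne_zero k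
  set I := Icc (1 : ℝ≥0) (1 + ((k : ℝ≥0) + 1)⁻¹) with hI
  have hIfin : leb I ≠ ∞ := by
    rw [leb_Icc]
    exact ENNReal.ofReal_ne_top
  have hb : ∀ x ∈ I, ‖Φ x - L‖ ≤ ε / 2 := by
    intro x hx
    rw [← dist_eq_norm]
    exact le_of_lt (hsub ⟨hx.1, hx.2.trans_lt (hN k hk)⟩)
  have hd : IntegrableOn (fun x => Φ x - L) I leb :=
    Measure.integrableOn_of_bounded hIfin (hm.sub stronglyMeasurable_const).aestronglyMeasurable
      ((ae_restrict_iff' measurableSet_Icc).2 (Eventually.of_forall hb))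
  have hΦI : IntegrableOn Φ I leb := by
    have := hd.add (integrableOn_const (C := L) hIfin)
    exact this.congr_fun (fun x _ => sub_add_cancel _ _) measurableSet_Icc
  have e1 : ∫ x, Φ x * bumpFun k x ∂leb = ((k : ℂ) + 1) * ∫ x in I, Φ x ∂leb := by
    rw [← integral_indicator measurableSet_Icc, ← integral_const_mul]
    congr 1
    ext x
    by_cases hx : x ∈ I
    · simp [bumpFun, ← hI, hx, mul_comm]
    · simp [bumpFun, ← hI, hx]
  have e2 : ∫ x in I, (Φ x - L) ∂leb = ∫ x in I, Φ x ∂leb - ((k : ℂ) + 1)⁻¹ * L := by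
    rw [integral_sub hΦI (integrableOn_const hIfin), setIntegral_const, leb_Icc_bump]
    simp
  have e3 : ‖∫ x in I, (Φ x - L) ∂leb‖ ≤ ε / 2 * ((k : ℝ) + 1)⁻¹ := by
    rw [← leb_Icc_bump]
    exact norm_setIntegral_le_of_norm_le_const hIfin.lt_top hb
  have e4 : ((k : ℂ) + 1) * ∫ x in I, Φ x ∂leb - L =
      ((k : ℂ) + 1) * ∫ x in I, (Φ x - L) ∂leb := by
    rw [e2]
    field_simp
  rw [dist_eq_norm, e1, e4, norm_mul]
  have : ‖(k : ℂ) + 1‖ = (k : ℝ) + 1 := by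
    have : ((k : ℂ) + 1) = (((k + 1 : ℕ) : ℝ) : ℂ) := by push_cast; ring
    rw [this, Complex.norm_real]
    simp
    positivity
  rw [this]
  calc _ ≤ ((k : ℝ) + 1) * (ε / 2 * ((k : ℝ) + 1)⁻¹) := by gcongr
    _ = ε / 2 := by field_simp
    _ < ε := half_lt_self hε

theorem exists_ultrafilter_tendsto_of_isCompact_weak {F : Type*} [AddCommGroup F] [Module ℂ F]
    [TopologicalSpace F] {u : ℕ → F} (hK : IsCompact (closure (toWeakSpace ℂ F '' range u))) :
    ∃ (U : Ultrafilter ℕ) (G : F), (U : Filter ℕ) ≤ atTop ∧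
      ∀ e : F →L[ℂ] ℂ, Tendsto (fun k => e (u k)) U (𝓝 (e G)) := by
  obtain ⟨G, -, hG⟩ := hK.ultrafilter_le_nhds ((hyperfilter ℕ).map fun k => toWeakSpace ℂ F (u k))
    (le_principal_iff.2 (mem_map.2 (univ_mem' fun k =>
      subset_closure (mem_image_of_mem _ (mem_range_self k)))))
  refine ⟨hyperfilter ℕ, (toWeakSpace ℂ F).symm G, Nat.hyperfilter_le_atTop, fun e => ?_⟩
  exact ((WeakBilin.eval_continuous (topDualPairing ℂ F).flip e).tendsto G).comp hG

theorem tendsto_restr_preimage_add (μ : MLoc) (n : ℕ) (t : ℝ≥0) :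
    Tendsto (fun x : ℝ≥0 => MLoc.restr n μ ((fun y => x + y) ⁻¹' Iio t)) (𝓝[≥] 1)
      (𝓝 (MLoc.restr n μ ((fun y => 1 + y) ⁻¹' Iio t))) := by
  obtain ⟨h, hh, hm⟩ := exists_density (MLoc.restr n μ)
  generalize (MLoc.restr n μ).variation = ρ at hh hm
  have hms : ∀ x : ℝ≥0, MeasurableSet ((fun y => x + y) ⁻¹' Iio t) := fun x =>
    (measurable_const_add x) measurableSet_Iio
  have e : ∀ x : ℝ≥0, ρ.withDensityᵥ h ((fun y => x + y) ⁻¹' Iio t) =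
      ∫ y, ((fun y => x + y) ⁻¹' Iio t).indicator h y ∂ρ := fun x => by
    rw [withDensityᵥ_apply hh (hms x), integral_indicator (hms x)]
  rw [← hm]
  simp only [e]
  refine tendsto_integral_filter_of_dominated_convergence (fun y => ‖h y‖) ?_ ?_ hh.norm ?_
  · exact Eventually.of_forall fun x => hh.1.indicator (hms x)
  · exact Eventually.of_forall fun x => Eventually.of_forall fun y => norm_indicator_le_norm_self _ _
  · refine Eventually.of_forall fun y => tendsto_nhds_of_eventually_eq ?_
    by_cases hy : 1 + y < t
    · have hc : ∀ᶠ x in 𝓝[≥] (1 : ℝ≥0), x + y < t :=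
        ((continuous_add_const y).tendsto 1).eventually (gt_mem_nhds hy) |>.filter_mono
          nhdsWithin_le_nhds
      filter_upwards [hc] with x hx
      simp [hx, hy]
    · filter_upwards [self_mem_nhdsWithin] with x hx
      have : ¬ x + y < t := fun h => hy (lt_of_le_of_lt (add_le_add_left hx y) h)
      simp [hy, this]

theorem tendsto_Dbar_bump_val (μ : MLoc) (t : ℝ≥0) :
    Tendsto (fun k => (Dbar μ (L1Loc.toMLoc (bump k))).val (Iio t)) atTop
      (𝓝 (μ.val ((fun y => 1 + y) ⁻¹' Iio t))) := by
  obtain ⟨n, hn⟩ := exists_nat_gt (max t 2)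
  have hnt : t < n := (le_max_left _ _).trans_lt hn
  have hn2 : (2 : ℝ≥0) < n := (le_max_right _ _).trans_lt hn
  have hsub : Iio t ⊆ Iio (n : ℝ≥0) := Iio_subset_Iio hnt.le
  have hmeas : Measurable fun p : ℝ≥0 × ℝ≥0 => p.1 + p.2 := measurable_add
  have hΦ : StronglyMeasurable fun x : ℝ≥0 =>
      MLoc.restr n μ ((fun y => x + y) ⁻¹' Iio t) * ((x : ℝ) : ℂ) :=
    (VectorMeasure.stronglyMeasurable_vectorMeasure_prodMk_left
      (hmeas measurableSet_Iio)).mul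
      (Complex.continuous_ofReal.comp NNReal.continuous_coe).stronglyMeasurable
  have hlim := (tendsto_restr_preimage_add μ n t).mul
    (((Complex.continuous_ofReal.comp NNReal.continuous_coe).tendsto 1).mono_left
      (nhdsWithin_le_nhds (s := Ici (1 : ℝ≥0))))
  have := tendsto_integral_bumpFun_mul hΦ hlim
  rw [MLoc.restr_apply_of_subset μ ((measurable_const_add (1 : ℝ≥0)) measurableSet_Iio)
    (fun y (hy : 1 + y < t) => lt_of_le_of_lt le_add_self (hy.trans hnt))] at this
  simp only [Function.comp_apply, NNReal.coe_one, Complex.ofReal_one, mul_one] at this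
  refine this.congr fun k => ?_
  have e : Dbar μ (L1Loc.toMLoc (bump k)) = MLoc.conv μ (L1Loc.toMLoc (L1Loc.X (bump k))) := by
    rw [← L1Loc.X_toMLoc]
    rfl
  have hk : ∀ x ∉ Iio (n : ℝ≥0), bumpFun k x = 0 := by
    intro x hx
    refine indicator_of_notMem (fun hx' => hx (lt_of_le_of_lt hx'.2 (lt_of_le_of_lt ?_ hn2))) _
    have : ((k : ℝ≥0) + 1)⁻¹ ≤ 1 := inv_le_one_of_one_le₀ (by simp)
    calc (1 : ℝ≥0) + ((k : ℝ≥0) + 1)⁻¹ ≤ 1 + 1 := by gcongr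
      _ = 2 := by norm_num
  rw [e, L1Loc.conv_toMLoc_val μ _ measurableSet_Iio hsub,
    ← setIntegral_eq_integral_of_forall_compl_eq_zero (s := Iio (n : ℝ≥0))
      (fun x hx => by rw [hk x hx, mul_zero])]
  apply integral_congr_ae
  filter_upwards [ae_restrict_of_ae (L1Loc.fn_mk _ (L1Loc.locallyIntegrable_X (bump k))),
    ae_restrict_of_ae (L1Loc.fn_mk _ (integrable_bumpFun k).locallyIntegrable)] with x h1 h2
  have h3 : (L1Loc.X (bump k)).fn x = ((x : ℝ) : ℂ) * (bump k).fn x := h1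
  have h4 : (bump k).fn x = bumpFun k x := h2
  rw [h3, h4, mul_assoc]

/-- If `G` vanishes on Lebesgue null sets and is the translate of `μ` by `1`, then `μ` is
absolutely continuous. -/
theorem MLoc.isAbsolutelyContinuous_of_translate {μ G : MLoc} (hG : G.IsAbsolutelyContinuous)
    (h : ∀ t : ℝ≥0, G.val (Iio t) = μ.val ((fun y => 1 + y) ⁻¹' Iio t)) :
    μ.IsAbsolutelyContinuous := by
  intro s hs hb h0
  obtain ⟨n, hn⟩ := MLoc.isBounded_iff.1 hb
  have hadd : Measurable fun y : ℝ≥0 => 1 + y := measurable_const_add 1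
  have hpre : ∀ t : ℝ≥0, (fun y : ℝ≥0 => 1 + y) ⁻¹' Iio t ∩ Iio (n : ℝ≥0) =
      (fun y : ℝ≥0 => 1 + y) ⁻¹' Iio (min t ((n + 1 : ℕ) : ℝ≥0)) := by
    intro t
    ext y
    simp [add_comm (1 : ℝ≥0) y]
  have hEq : MLoc.restr (n + 1) G = (MLoc.restr n μ).map fun y => 1 + y := by
    have key : ∀ t : ℝ≥0, MLoc.restr (n + 1) G (Iio t) =
        (MLoc.restr n μ).map (fun y => 1 + y) (Iio t) := by
      intro t
      rw [VectorMeasure.map_apply _ hadd measurableSet_Iio, MLoc.restr_apply _ _ measurableSet_Iio,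
        MLoc.restr_apply _ _ (hadd measurableSet_Iio), hpre, Iio_inter_Iio, h]
    refine VectorMeasure.ext_of_generateFrom (range Iio) ?_
      (BorelSpace.measurable_eq.trans (borel_eq_generateFrom_Iio _)) isPiSystem_Iio ?_
    · rintro _ ⟨t, rfl⟩
      exact key t
    · have h1 := key ((n + 1 : ℕ) : ℝ≥0)
      rw [VectorMeasure.map_apply _ hadd measurableSet_Iio, MLoc.restr_apply _ _ measurableSet_Iio,
        MLoc.restr_apply _ _ (hadd measurableSet_Iio), hpre, inter_self, min_self] at h1
      rw [VectorMeasure.map_apply _ hadd MeasurableSet.univ, MLoc.restr_apply _ _ MeasurableSet.univ,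
        MLoc.restr_apply _ _ (hadd MeasurableSet.univ), univ_inter, preimage_univ, univ_inter, h1]
      congr 1
      ext y
      simp [add_comm (1 : ℝ≥0) y]
  have hsm : MeasurableSet ((fun x : ℝ≥0 => x - 1) ⁻¹' s) := (measurable_id.sub_const 1) hs
  set T : Set ℝ≥0 := (fun x => x - 1) ⁻¹' s ∩ Ici 1 with hT
  have hTm : MeasurableSet T := hsm.inter measurableSet_Ici
  have hTs : (fun y : ℝ≥0 => 1 + y) ⁻¹' T = s := by
    ext y
    simp [hT]
  have hT0 : leb T = 0 := by
    rw [hT, ← Measure.restrict_apply hsm, ← map_add_leb,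
      Measure.map_apply (by fun_prop) hsm, ← h0]
    congr 1
    ext y
    simp
  rw [← MLoc.restr_apply_of_subset μ hs hn, ← hTs, ← VectorMeasure.map_apply _ hadd hTm, ← hEq,
    MLoc.restr_apply _ _ hTm]
  exact hG _ (hTm.inter measurableSet_Iio) ((MLoc.isBounded_Iio _).subset inter_subset_right)
    (measure_mono_null inter_subset_left hT0)

theorem isAbsolutelyContinuous_of_isCompact_weak {μ : MLoc}
    (hK : IsCompact (closure (toWeakSpace ℂ MLoc '' (Dbar μ '' (L1Loc.toMLoc '' range bump))))) :
    μ.IsAbsolutelyContinuous := by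
  rw [← range_comp, ← range_comp] at hK
  obtain ⟨U, G, hU, hG⟩ := exists_ultrafilter_tendsto_of_isCompact_weak hK
  refine MLoc.isAbsolutelyContinuous_of_translate (G := G) (fun s hs hb h0 => ?_) fun t => ?_
  · refine tendsto_nhds_unique (hG (MLoc.evalCLM s hs hb)) (tendsto_nhds_of_eventually_eq ?_)
    refine Eventually.of_forall fun k => ?_
    change (Dbar μ (L1Loc.toMLoc (bump k))).val s = 0
    rw [Dbar_toMLoc, L1Loc.val_toMLoc _ hs hb, Measure.restrict_eq_zero.2 h0, integral_zero_measure]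
  · exact tendsto_nhds_unique (hG (MLoc.evalCLM (Iio t) measurableSet_Iio (MLoc.isBounded_Iio t)))
      ((tendsto_Dbar_bump_val μ t).mono_left hU)

/-! ### Compact subsets of `L¹_loc` -/

namespace L1Loc

/-- The Banach space of integrable functions on `[k, k + 1)`. -/
abbrev Piece (k : ℕ) : Type := Lp ℂ 1 (leb.restrict (Ico (k : ℝ≥0) (k + 1)))

theorem integrable_Ico (f : L1Loc) (k : ℕ) :
    Integrable f.fn (leb.restrict (Ico (k : ℝ≥0) (k + 1))) :=
  f.integrableOn_fn_of_isBounded (Metric.isBounded_Ico _ _)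

theorem norm_toL1_Ico (f : L1Loc) (k : ℕ) :
    ‖(f.integrable_Ico k).toL1 f.fn‖ = ∫ x in Ico (k : ℝ≥0) (k + 1), ‖f.fn x‖ ∂leb := by
  rw [Integrable.norm_toL1_eq_lintegral_enorm,
    integral_norm_eq_lintegral_enorm (f.integrable_Ico k).1]

/-- Restriction of an element of `L¹_loc` to `[k, k + 1)`. -/
def toPiece (k : ℕ) : L1Loc →ₗ[ℂ] Piece k where
  toFun f := (f.integrable_Ico k).toL1 f.fn
  map_add' f g := by
    rw [← Integrable.toL1_add]
    exact (Integrable.toL1_eq_toL1_iff _ _ _ _).2 (ae_restrict_of_ae (fn_add f g))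
  map_smul' c f := by
    rw [RingHom.id_apply, ← Integrable.toL1_smul]
    exact (Integrable.toL1_eq_toL1_iff _ _ _ _).2 (ae_restrict_of_ae (fn_smul c f))

theorem norm_toPiece_le (k : ℕ) (f : L1Loc) : ‖toPiece k f‖ ≤ seminorm (k + 1) f := by
  refine (norm_toL1_Ico f k).trans_le ?_
  refine setIntegral_mono_set (f.integrableOn_fn (k + 1)).norm
    (Eventually.of_forall fun x => norm_nonneg _) (LE.le.eventuallyLE fun x hx => ?_)
  push_cast
  exact hx.2

theorem continuous_toPiece (k : ℕ) : Continuous (toPiece k) := by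
  refine WithSeminorms.continuous_normedSpace_rng (Piece k) withSeminorms (toPiece k)
    ⟨{k + 1}, 1, fun f => ?_⟩
  rw [Finset.sup_singleton, one_smul]
  exact norm_toPiece_le k f

theorem floor_apply_of_mem_Ico (g : ∀ k, Piece k) {k : ℕ} {t : ℝ≥0}
    (ht : t ∈ Ico (k : ℝ≥0) (k + 1)) : g ⌊t⌋₊ t = g k t := by
  obtain rfl : ⌊t⌋₊ = k := (Nat.floor_eq_iff zero_le).2 ht
  rfl

theorem locallyIntegrable_pieces (g : ∀ k, Piece k) :
    LocallyIntegrable (fun t : ℝ≥0 => g ⌊t⌋₊ t) leb :=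
  locallyIntegrable_of_integrableOn_Ico fun k =>
    IntegrableOn.congr_fun (L1.integrable_coeFn (g k))
      (fun _ ht => (floor_apply_of_mem_Ico g ht).symm) measurableSet_Ico

theorem ae_of_forall_Ico {P : ℝ≥0 → Prop}
    (h : ∀ k : ℕ, ∀ᵐ t ∂leb.restrict (Ico (k : ℝ≥0) (k + 1)), P t) : ∀ᵐ t ∂leb, P t := by
  have : (univ : Set ℝ≥0) = ⋃ k : ℕ, Ico (k : ℝ≥0) (k + 1) := by
    ext x
    simpa using ⟨⌊x⌋₊, Nat.floor_le zero_le, Nat.lt_floor_add_one x⟩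
  rw [← Measure.restrict_univ (μ := leb), this, ae_restrict_iUnion_iff]
  exact h

/-- The element of `L¹_loc` with prescribed restrictions to the intervals `[k, k + 1)`. -/
def ofPieces : (∀ k, Piece k) →ₗ[ℂ] L1Loc where
  toFun g := mk _ (locallyIntegrable_pieces g)
  map_add' g h := by
    apply ext
    apply ae_of_forall_Ico
    intro k
    filter_upwards [ae_restrict_of_ae (fn_mk _ (locallyIntegrable_pieces (g + h))),
      ae_restrict_of_ae (fn_mk _ (locallyIntegrable_pieces g)),
      ae_restrict_of_ae (fn_mk _ (locallyIntegrable_pieces h)),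
      ae_restrict_of_ae (fn_add (mk _ (locallyIntegrable_pieces g))
        (mk _ (locallyIntegrable_pieces h))),
      Lp.coeFn_add (g k) (h k), ae_restrict_mem measurableSet_Ico] with t h1 h2 h3 h4 h5 ht
    rw [h1, h4, h2, h3, floor_apply_of_mem_Ico _ ht, floor_apply_of_mem_Ico _ ht, floor_apply_of_mem_Ico _ ht]
    exact h5
  map_smul' c g := by
    apply ext
    apply ae_of_forall_Ico
    intro k
    filter_upwards [ae_restrict_of_ae (fn_mk _ (locallyIntegrable_pieces (c • g))),
      ae_restrict_of_ae (fn_mk _ (locallyIntegrable_pieces g)),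
      ae_restrict_of_ae (fn_smul c (mk _ (locallyIntegrable_pieces g))),
      Lp.coeFn_smul c (g k), ae_restrict_mem measurableSet_Ico] with t h1 h2 h3 h4 ht
    rw [RingHom.id_apply, h1, h3, h2, floor_apply_of_mem_Ico _ ht, floor_apply_of_mem_Ico _ ht]
    exact h4

theorem seminorm_ofPieces (n : ℕ) (g : ∀ k, Piece k) :
    seminorm n (ofPieces g) = ∑ k ∈ Finset.range n, ‖g k‖ := by
  have hd : Set.Pairwise (↑(Finset.range n))
      (Function.onFun Disjoint fun k : ℕ => Ico (k : ℝ≥0) (k + 1)) := by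
    intro i _ j _ hij
    refine disjoint_left.2 fun x hx hy => hij ?_
    rw [← (Nat.floor_eq_iff zero_le).2 hx, ← (Nat.floor_eq_iff zero_le).2 hy]
  rw [seminorm_apply, Iio_eq_iUnion_Ico, integral_biUnion_finset _ (fun _ _ => measurableSet_Ico) hd
    fun k _ => ((ofPieces g).integrable_Ico k).norm]
  refine Finset.sum_congr rfl fun k _ => ?_
  rw [L1.norm_eq_integral_norm]
  apply integral_congr_ae
  filter_upwards [ae_restrict_of_ae (fn_mk _ (locallyIntegrable_pieces g)),
    ae_restrict_mem measurableSet_Ico] with t h1 ht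
  have h2 : (ofPieces g).fn t = g ⌊t⌋₊ t := h1
  rw [h2, ← floor_apply_of_mem_Ico g ht]

theorem continuous_ofPieces : Continuous ofPieces := by
  refine withSeminorms.continuous_of_continuous_comp _ fun n => ?_
  have : ⇑((seminorm n).comp ofPieces) = fun g => ∑ k ∈ Finset.range n, ‖g k‖ :=
    funext fun g => seminorm_ofPieces n g
  rw [this]
  fun_prop

theorem ofPieces_toPiece (f : L1Loc) : ofPieces (fun k => toPiece k f) = f := by
  apply ext
  apply ae_of_forall_Ico
  intro k
  filter_upwards [ae_restrict_of_ae (fn_mk _ (locallyIntegrable_pieces fun k => toPiece k f)),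
    Integrable.coeFn_toL1 (f.integrable_Ico k), ae_restrict_mem measurableSet_Ico] with t h1 h2 ht
  have h3 := floor_apply_of_mem_Ico (fun k => toPiece k f) ht
  exact h1.trans (h3.trans h2)

/-- A set in `L¹_loc` that can be approximated by compact sets, with respect to every seminorm,
is relatively compact. -/
theorem isCompact_closure_of_forall_exists_isCompact {A : Set L1Loc}
    (hA : ∀ (n : ℕ) (ε : ℝ), 0 < ε → ∃ K : Set L1Loc, IsCompact K ∧
      ∀ a ∈ A, ∃ b ∈ K, seminorm n (a - b) ≤ ε) : IsCompact (closure A) := by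
  have hC : ∀ k, IsCompact (closure (toPiece k '' A)) := by
    intro k
    refine (TotallyBounded.closure ?_).isCompact_of_isClosed isClosed_closure
    rw [Metric.totallyBounded_iff]
    intro ε hε
    obtain ⟨K, hK, hKA⟩ := hA (k + 1) (ε / 3) (by positivity)
    obtain ⟨t, htf, ht⟩ := Metric.totallyBounded_iff.1
      (hK.image (continuous_toPiece k)).totallyBounded (ε / 3) (by positivity)
    refine ⟨t, htf, ?_⟩
    rintro _ ⟨a, ha, rfl⟩
    obtain ⟨b, hb, hab⟩ := hKA a ha
    obtain ⟨c, hc, hbc⟩ := mem_iUnion₂.1 (ht ⟨b, hb, rfl⟩)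
    refine mem_iUnion₂.2 ⟨c, hc, ?_⟩
    have h1 : dist (toPiece k a) (toPiece k b) ≤ ε / 3 := by
      rw [dist_eq_norm, ← map_sub]
      exact (norm_toPiece_le k _).trans hab
    have h2 := Metric.mem_ball.1 hbc
    have h3 := dist_triangle (toPiece k a) (toPiece k b) c
    exact Metric.mem_ball.2 (by linarith)
  refine ((isCompact_univ_pi hC).image continuous_ofPieces).closure_of_subset fun a ha => ?_
  exact ⟨fun k => toPiece k a, fun k _ => subset_closure ⟨a, ha, rfl⟩, ofPieces_toPiece a⟩

end L1Loc

/-! ### Continuity of translation -/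

theorem exists_forall_lintegral_translate_sub_le {φ : ℝ → ℂ} (hφ : Integrable φ) {ε : ℝ}
    (hε : 0 < ε) : ∃ δ > 0, ∀ s : ℝ, |s| < δ → ∫⁻ x, ‖φ (s + x) - φ x‖ₑ ≤ ENNReal.ofReal ε := by
  have : Fact ((1 : ℝ≥0∞) ≠ ∞) := ⟨ENNReal.one_ne_top⟩
  have hc : Continuous fun s : ℝ => DomAddAct.mk s +ᵥ hφ.toL1 φ :=
    (DomAddAct.continuous_mk).vadd continuous_const
  have h0 := Metric.continuous_iff.1 hc 0 ε hε
  obtain ⟨δ, hδ, h⟩ := h0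
  refine ⟨δ, hδ, fun s hs => ?_⟩
  have h1 := h s (by simpa using hs)
  have h2 : MemLp (fun x => φ (s +ᵥ x)) 1 volume :=
    ((memLp_one_iff_integrable.2 hφ).comp_measurePreserving (measurePreserving_vadd s volume))
  have h3 : DomAddAct.mk s +ᵥ hφ.toL1 φ = h2.toLp _ := rfl
  have h4 : DomAddAct.mk (0 : ℝ) +ᵥ hφ.toL1 φ = hφ.toL1 φ := by
    rw [DomAddAct.mk_zero, zero_vadd]
  rw [h3, h4] at h1
  have h5 : edist (h2.toLp _) (hφ.toL1 φ) = ∫⁻ x, ‖φ (s + x) - φ x‖ₑ := by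
    have := Lp.edist_toLp_toLp _ _ h2 (memLp_one_iff_integrable.2 hφ)
    rw [eLpNorm_one_eq_lintegral_enorm] at this
    exact this
  rw [← h5, edist_dist]
  exact ENNReal.ofReal_le_ofReal h1.le

theorem map_coe_leb : leb.map ((↑) : ℝ≥0 → ℝ) = volume.restrict (Ici 0) := by
  rw [leb, measurableEmbedding_coe.map_comap]
  congr 1
  ext x
  exact ⟨fun ⟨y, hy⟩ => hy ▸ y.2, fun hx => ⟨⟨x, hx⟩, rfl⟩⟩

namespace L1Loc

/-- The extension by zero to `ℝ` of the restriction of `g` to `[0, n)`. -/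
def extendReal (g : ℝ≥0 → ℂ) (n : ℕ) : ℝ → ℂ :=
  (Ici (0 : ℝ)).indicator fun u => (Iio (n : ℝ≥0)).indicator g u.toNNReal

theorem integrable_extendReal {g : ℝ≥0 → ℂ} (hg : LocallyIntegrable g leb) (n : ℕ) :
    Integrable (extendReal g n) := by
  rw [extendReal, integrable_indicator_iff measurableSet_Ici, IntegrableOn, ← map_coe_leb,
    measurableEmbedding_coe.integrable_map_iff]
  refine ((integrable_indicator_iff measurableSet_Iio).2 (locallyIntegrable_iff.1 hg n)).congr ?_
  exact Eventually.of_forall fun x => by simp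

theorem kernel_eq_extendReal (g : ℝ≥0 → ℂ) {n : ℕ} {t : ℝ≥0} (ht : t < n) (s : ℝ≥0) :
    (Iic t).indicator (fun s => g (t - s)) s = extendReal g n ((t : ℝ) - s) := by
  by_cases h : s ≤ t
  · have h1 : ((t : ℝ) - s) = ((t - s : ℝ≥0) : ℝ) := (NNReal.coe_sub h).symm
    have h2 : t - s < n := lt_of_le_of_lt tsub_le_self ht
    rw [h1, extendReal, indicator_of_mem (mem_Ici.2 (NNReal.coe_nonneg _)), Real.toNNReal_coe,
      indicator_of_mem (mem_Iio.2 h2), indicator_of_mem (mem_Iic.2 h)]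
  · have h1 : ((t : ℝ) - s) ∉ Ici (0 : ℝ) := by
      have : (t : ℝ) < s := by exact_mod_cast not_le.1 h
      simpa using this
    rw [extendReal, indicator_of_notMem h1, indicator_of_notMem (by simpa using h)]

theorem exists_forall_lintegral_kernel_sub_le {g : ℝ≥0 → ℂ} (hg : LocallyIntegrable g leb) (n : ℕ)
    {ε : ℝ} (hε : 0 < ε) : ∃ δ > 0, ∀ s s' : ℝ≥0, |(s : ℝ) - s'| < δ →
      ∫⁻ t in Iio (n : ℝ≥0), ‖(Iic t).indicator (fun s => g (t - s)) s -
        (Iic t).indicator (fun s => g (t - s)) s'‖ₑ ∂leb ≤ ENNReal.ofReal ε := by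
  obtain ⟨δ, hδ, h⟩ := exists_forall_lintegral_translate_sub_le (integrable_extendReal hg n) hε
  refine ⟨δ, hδ, fun s s' hs => ?_⟩
  set φ := extendReal g n
  calc _ = ∫⁻ t in Iio (n : ℝ≥0), ‖φ ((t : ℝ) - s) - φ ((t : ℝ) - s')‖ₑ ∂leb := by
        refine setLIntegral_congr_fun measurableSet_Iio fun t ht => ?_
        rw [kernel_eq_extendReal g ht, kernel_eq_extendReal g ht]
    _ ≤ ∫⁻ t : ℝ≥0, ‖φ ((t : ℝ) - s) - φ ((t : ℝ) - s')‖ₑ ∂leb := setLIntegral_le_lintegral _ _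
    _ = ∫⁻ u in Ici (0 : ℝ), ‖φ (u - s) - φ (u - s')‖ₑ := by
        rw [← map_coe_leb, measurableEmbedding_coe.lintegral_map]
    _ ≤ ∫⁻ u : ℝ, ‖φ (u - s) - φ (u - s')‖ₑ := setLIntegral_le_lintegral _ _
    _ = ∫⁻ x : ℝ, ‖φ ((s' - s) + x) - φ x‖ₑ := by
        rw [← lintegral_add_right_eq_self _ (s' : ℝ)]
        refine lintegral_congr fun x => ?_
        rw [add_sub_cancel_right]
        congr 3
        ring
    _ ≤ _ := h _ (by rwa [abs_sub_comm])

theorem locallyIntegrable_translate (g : L1Loc) (x : ℝ≥0) :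
    LocallyIntegrable (fun t => (Iic t).indicator (fun s => g.fn (t - s)) x) leb := by
  rw [locallyIntegrable_iff]
  intro n
  have h := (stronglyMeasurable_kernel g.stronglyMeasurable_fn).comp_measurable
    (measurable_id.prodMk (measurable_const (a := x)))
  exact ⟨h.aestronglyMeasurable, (lintegral_kernel_le g.stronglyMeasurable_fn n x).trans_lt
    (g.integrableOn_fn n).2⟩

/-- Translation to the right on `L¹_loc`. -/
def translate (x : ℝ≥0) (g : L1Loc) : L1Loc := mk _ (locallyIntegrable_translate g x)

theorem fn_sum {ι : Type*} (s : Finset ι) (f : ι → L1Loc) :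
    (∑ i ∈ s, f i).fn =ᵐ[leb] fun t => ∑ i ∈ s, (f i).fn t := by
  classical
  induction s using Finset.induction_on with
  | empty => simpa using! (AEEqFun.coeFn_zero : ⇑(0 : ℝ≥0 →ₘ[leb] ℂ) =ᵐ[leb] 0)
  | insert i s hi ih =>
    filter_upwards [fn_add (f i) (∑ i ∈ s, f i), ih] with t h1 h2
    rw [Finset.sum_insert hi, Finset.sum_insert hi, h1, h2]

theorem fn_sub (f g : L1Loc) : (f - g).fn =ᵐ[leb] fun x => f.fn x - g.fn x :=
  AEEqFun.coeFn_sub f.1 g.1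

theorem seminorm_eq_lintegral (n : ℕ) (f : L1Loc) :
    seminorm n f = (∫⁻ x in Iio (n : ℝ≥0), ‖f.fn x‖ₑ ∂leb).toReal := by
  rw [seminorm_apply, integral_norm_eq_lintegral_enorm (f.integrableOn_fn n).1]

/-- Convolution with `ν` is approximated on `[0, n)` by a linear combination of translations by
the points `j δ`. -/
theorem seminorm_conv_sub_sum_translate_le (g : L1Loc) {n N : ℕ} {δ : ℝ≥0} (hδ : 0 < δ)
    (hN : (n : ℝ≥0) / δ ≤ N) {ε : ℝ} (hε : 0 ≤ ε)
    (h : ∀ s s' : ℝ≥0, |(s : ℝ) - s'| < δ →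
      ∫⁻ t in Iio (n : ℝ≥0), ‖(Iic t).indicator (fun s => g.fn (t - s)) s -
        (Iic t).indicator (fun s => g.fn (t - s)) s'‖ₑ ∂leb ≤ ENNReal.ofReal ε) (ν : MLoc) :
    seminorm n (conv ν g - ∑ j ∈ Finset.range N,
      ν.val {s | ⌊s / δ⌋₊ = j ∧ s < n} • translate (j * δ) g) ≤ ε * MLoc.seminorm n ν := by
  set K : ℝ≥0 → ℝ≥0 → ℂ := fun t s => (Iic t).indicator (fun s => g.fn (t - s)) s with hK
  have hKm : StronglyMeasurable fun p : ℝ≥0 × ℝ≥0 => K p.1 p.2 :=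
    stronglyMeasurable_kernel g.stronglyMeasurable_fn
  set I : ℕ → Set ℝ≥0 := fun j => {s | ⌊s / δ⌋₊ = j ∧ s < n} with hI
  have hIm : ∀ j, MeasurableSet (I j) := fun j =>
    (((measurable_id.div_const δ).nat_floor) (measurableSet_singleton j)).inter measurableSet_Iio
  have hIn : ∀ j, I j ⊆ Iio (n : ℝ≥0) := fun j s hs => hs.2
  set Q : ℝ≥0 → ℝ≥0 → ℂ := fun t s => ∑ j ∈ Finset.range N, (I j).indicator (fun _ => K t (j * δ)) s
    with hQ
  have hQm : StronglyMeasurable fun p : ℝ≥0 × ℝ≥0 => Q p.1 p.2 := by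
    refine Finset.stronglyMeasurable_fun_sum _ fun j _ => ?_
    have h1 : StronglyMeasurable fun p : ℝ≥0 × ℝ≥0 => K p.1 (j * δ) :=
      hKm.comp_measurable (measurable_fst.prodMk measurable_const)
    exact h1.indicator (s := {p : ℝ≥0 × ℝ≥0 | p.2 ∈ I j}) (measurable_snd (hIm j))
  set m := MLoc.restr n ν with hm
  have hfn : ∀ᵐ t ∂leb.restrict (Iio (n : ℝ≥0)),
      ‖(conv ν g - ∑ j ∈ Finset.range N, ν.val (I j) • translate (j * δ) g).fn t‖ₑ ≤
        ∫⁻ s, ‖K t s - Q t s‖ₑ ∂m.variation := by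
    have h1 : ∀ᵐ t ∂leb, ∀ j ∈ Finset.range N, (ν.val (I j) • translate (j * δ) g).fn t =
        ν.val (I j) * K t (j * δ) := by
      refine (Finset.eventually_all _).2 fun j _ => ?_
      filter_upwards [fn_smul (ν.val (I j)) (translate (j * δ) g),
        fn_mk _ (locallyIntegrable_translate g (j * δ))] with t h1 h2
      have h3 : (translate (j * δ) g).fn t = K t (j * δ) := h2
      rw [h1, h3]
    filter_upwards [ae_restrict_of_ae h1, ae_restrict_of_ae (fn_sub (conv ν g)
        (∑ j ∈ Finset.range N, ν.val (I j) • translate (j * δ) g)),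
      ae_restrict_of_ae (fn_sum (Finset.range N) fun j => ν.val (I j) • translate (j * δ) g),
      ae_restrict_of_ae (fn_mk _ (locallyIntegrable_conv ν g)), ae_restrict_mem measurableSet_Iio,
      ae_integrable_kernel g.stronglyMeasurable_fn g.locallyIntegrable_fn ν n]
      with t h1 h2 h3 h4 ht hint
    have h4' : (conv ν g).fn t = ∫ᵛ s, K t s ∂[mulC; m] := h4.trans (convFun_eq g.fn ν ht)
    have hi : ∀ j ∈ Finset.range N, m.Integrable ((I j).indicator fun _ => K t (j * δ)) :=
      fun j _ => (integrable_const (μ := m.variation) (K t (j * δ))).indicator (hIm j)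
    have h5 : ∫ᵛ s, Q t s ∂[mulC; m] = ∑ j ∈ Finset.range N, ν.val (I j) * K t (j * δ) := by
      rw [VectorMeasure.integral_finsetSum _ hi]
      refine Finset.sum_congr rfl fun j _ => ?_
      rw [VectorMeasure.integral_indicator_const _ (hIm j), hm,
        MLoc.restr_apply_of_subset ν (hIm j) (hIn j)]
      exact mul_comm _ _
    have hQi : m.Integrable (Q t) := VectorMeasure.Integrable.fun_finsetSum _ hi
    rw [h2, h3, Finset.sum_congr rfl h1, h4', ← h5, ← VectorMeasure.integral_fun_sub hint hQi]
    refine VectorMeasure.enorm_integral_le_lintegral_enorm.trans ?_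
    have : ‖mulC‖ₑ = 1 := by
      rw [← ofReal_norm, ContinuousLinearMap.opNorm_mul]; simp
    rw [this, one_mul]
  have hle : ∫⁻ t in Iio (n : ℝ≥0),
      ‖(conv ν g - ∑ j ∈ Finset.range N, ν.val (I j) • translate (j * δ) g).fn t‖ₑ ∂leb ≤
        ENNReal.ofReal ε * m.variation univ := by
    refine (lintegral_mono_ae hfn).trans ?_
    rw [lintegral_lintegral_swap (hKm.sub hQm).enorm.aemeasurable, ← lintegral_const]
    refine lintegral_mono_ae ?_
    have h4 : ∀ᵐ x ∂m.variation, x ∈ Iio (n : ℝ≥0) := MLoc.variation_restr_compl n ν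
    filter_upwards [h4] with s hs
    have hsN : ⌊s / δ⌋₊ ∈ Finset.range N := by
      rw [Finset.mem_range, Nat.floor_lt zero_le]
      exact (div_lt_div_of_pos_right hs hδ).trans_le hN
    have hQs : ∀ t, Q t s = K t (⌊s / δ⌋₊ * δ) := by
      intro t
      rw [hQ]
      dsimp only
      rw [Finset.sum_eq_single_of_mem _ hsN]
      · exact indicator_of_mem (show s ∈ I ⌊s / δ⌋₊ from ⟨rfl, hs⟩) _
      · exact fun j _ hj => indicator_of_notMem (fun hs' => hj hs'.1.symm) _
    simp only [hQs]
    refine h s _ ?_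
    have h5 : (⌊s / δ⌋₊ : ℝ≥0) * δ ≤ s := (le_div_iff₀ hδ).1 (Nat.floor_le zero_le)
    have h6 : s < (⌊s / δ⌋₊ + 1 : ℝ≥0) * δ := (div_lt_iff₀ hδ).1 (Nat.lt_floor_add_one _)
    rw [← NNReal.coe_sub h5, abs_of_nonneg (NNReal.coe_nonneg _), NNReal.coe_lt_coe,
      tsub_lt_iff_left h5]
    linarith
  rw [seminorm_eq_lintegral, MLoc.seminorm_apply, measureReal_def, ← ENNReal.toReal_ofReal hε,
    ← ENNReal.toReal_mul]
  exact ENNReal.toReal_mono (ENNReal.mul_ne_top ENNReal.ofReal_ne_top (measure_ne_top _ _)) hle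

/-- Convolution with a fixed element of `L¹_loc` maps bounded sets of measures to relatively
compact sets. -/
theorem isCompact_closure_image_conv (g : L1Loc) {B : Set MLoc}
    (hB : Bornology.IsVonNBounded ℂ B) : IsCompact (closure ((fun ν => conv ν g) '' B)) := by
  rw [MLoc.withSeminorms.isVonNBounded_iff_seminorm_bounded] at hB
  refine isCompact_closure_of_forall_exists_isCompact fun n ε hε => ?_
  obtain ⟨C, hC, hBC⟩ := hB n
  obtain ⟨δ, hδ, h⟩ := exists_forall_lintegral_kernel_sub_le g.locallyIntegrable_fn n (div_pos hε hC)
  lift δ to ℝ≥0 using hδ.le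
  have hδ' : 0 < δ := by exact_mod_cast hδ
  obtain ⟨N, hN⟩ := exists_nat_ge ((n : ℝ≥0) / δ)
  have hcont : Continuous fun c : ℕ → ℂ => ∑ j ∈ Finset.range N, c j • translate (j * δ) g :=
    continuous_finsetSum _ fun j _ => (continuous_apply j).smul continuous_const
  refine ⟨_, (isCompact_univ_pi fun _ => isCompact_closedBall (0 : ℂ) C).image hcont, ?_⟩
  rintro _ ⟨ν, hν, rfl⟩
  refine ⟨_, ⟨fun j => ν.val {s | ⌊s / δ⌋₊ = j ∧ s < n}, fun j _ => ?_, rfl⟩, ?_⟩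
  · have hm : MeasurableSet {s : ℝ≥0 | ⌊s / δ⌋₊ = j ∧ s < n} :=
      (((measurable_id.div_const δ).nat_floor) (measurableSet_singleton j)).inter measurableSet_Iio
    rw [mem_closedBall_zero_iff]
    exact (MLoc.norm_val_le ν hm fun s hs => hs.2).trans (hBC ν hν).le
  · refine (seminorm_conv_sub_sum_translate_le g hδ' hN (div_pos hε hC).le h ν).trans ?_
    calc ε / C * MLoc.seminorm n ν ≤ ε / C * C := by gcongr; exact (hBC ν hν).le
      _ = ε := div_mul_cancel₀ _ hC.ne'

end L1Loc

theorem isVonNBounded_image_X {B : Set MLoc} (hB : Bornology.IsVonNBounded ℂ B) :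
    Bornology.IsVonNBounded ℂ (MLoc.X '' B) := by
  rw [MLoc.withSeminorms.isVonNBounded_iff_seminorm_bounded] at hB ⊢
  intro n
  obtain ⟨C, hC, hBC⟩ := hB n
  refine ⟨n * C + 1, by positivity, ?_⟩
  rintro _ ⟨ν, hν, rfl⟩
  have h1 := MLoc.seminorm_X_le n ν
  have h2 : (n : ℝ) * MLoc.seminorm n ν ≤ n * C := by gcongr; exact (hBC ν hν).le
  linarith

theorem Dbar_toMLoc_eq (h : L1Loc) (ν : MLoc) :
    Dbar (L1Loc.toMLoc h) ν = L1Loc.toMLoc (L1Loc.conv (MLoc.X ν) h) := by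
  change MLoc.conv (L1Loc.toMLoc h) (MLoc.X ν) = _
  rw [MLoc.conv_apply_comm, L1Loc.conv_toMLoc]

theorem D_toMLoc_eq (h f : L1Loc) :
    D (L1Loc.toMLoc h) f = L1Loc.conv (MLoc.X (L1Loc.toMLoc f)) h :=
  L1Loc.toMLoc_injective (by rw [← Dbar_toMLoc, Dbar_toMLoc_eq])

theorem isMontel_Dbar_toMLoc (h : L1Loc) : IsMontel (Dbar (L1Loc.toMLoc h)) := by
  intro B hB
  refine ((L1Loc.isCompact_closure_image_conv h (isVonNBounded_image_X hB)).image
    L1Loc.toMLocCLM.continuous).closure_of_subset ?_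
  rintro _ ⟨ν, hν, rfl⟩
  rw [Dbar_toMLoc_eq]
  exact ⟨_, subset_closure ⟨_, ⟨ν, hν, rfl⟩, rfl⟩, rfl⟩

theorem isMontel_D_toMLoc (h : L1Loc) : IsMontel (D (L1Loc.toMLoc h)) := by
  intro B hB
  refine (L1Loc.isCompact_closure_image_conv h (isVonNBounded_image_X
    (isVonNBounded_image_toMLoc hB))).closure_of_subset ?_
  rintro _ ⟨f, hf, rfl⟩
  rw [D_toMLoc_eq]
  exact subset_closure ⟨_, ⟨_, ⟨f, hf, rfl⟩, rfl⟩, rfl⟩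

end LocConv

end

theorem mainTheorem2 (μ : LocConv.MLoc) :
    List.TFAE
      [LocConv.IsMontel (LocConv.D μ),
       LocConv.IsWeaklyMontel (LocConv.D μ),
       μ.IsAbsolutelyContinuous,
       LocConv.IsMontel (LocConv.Dbar μ),
       LocConv.IsWeaklyMontel (LocConv.Dbar μ)] := by
  tfae_have 1 → 2 := fun h => h.isWeaklyMontel
  tfae_have 2 → 3 := fun h => LocConv.isAbsolutelyContinuous_of_isCompact_weak
    (LocConv.isCompact_closure_of_isWeaklyMontel_D h LocConv.isVonNBounded_range_bump)
  tfae_have 3 → 1 := fun h => by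
    obtain ⟨g, rfl⟩ := h.exists_toMLoc_eq
    exact LocConv.isMontel_D_toMLoc g
  tfae_have 3 → 4 := fun h => by
    obtain ⟨g, rfl⟩ := h.exists_toMLoc_eq
    exact LocConv.isMontel_Dbar_toMLoc g
  tfae_have 4 → 5 := fun h => h.isWeaklyMontel
  tfae_have 5 → 3 := fun h => LocConv.isAbsolutelyContinuous_of_isCompact_weak
    (h _ (LocConv.isVonNBounded_image_toMLoc LocConv.isVonNBounded_range_bump))
  tfae_finish
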